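/- **Conventions.** Let $\Bbbk$ be a field of characteristic zero. Chain complexes over $\Bbbk$ are $\mathbb{Z}$-graded, $V=\bigoplus_{n\in\mathbb Z}V_n$, with a differential $\partial$ of degree $-1$. Tensor products are graded by total degree and the Koszul sign rule is used throughout: $(f\otimes g)(x\otimes y)=(-1)^{|g||x|}f(x)\otimes g(y)$, $\tau(x\otimes y)=(-1)^{|x||y|}y\otimes x$, $\partial_{V\otimes W}=\partial\otimes 1+1\otimes\partial$, and $\partial f=\partial\circ f-(-1)^{|f|}f\circ\partial$ for a homogeneous linear map $f$. A *ccdg-coalgebra* is a chain complex $C$ with degree $0$ chain maps $\epsilon:C\to\Bbbk$ and $\Delta:C\to C\otimes C$ that are counital, coassociative and cocommutative ($\tau\circ\Delta=\Delta$). A morphism of ccdg-coalgebras is a degree $0$ chain map $f$ with $\epsilon\circ f=\epsilon$ and $\Delta\circ f=(f\otimes f)\circ\Delta$. A *ccdg-Hopf algebra* is a ccdg-coalgebra $\Omega$ with degree $0$ chain maps $u:\Bbbk\to\Omega$ and $m:\Omega\otimes\Omega\to\Omega$ which are compatible with $\epsilon$ and $\Delta$ and make $\Omega$ a unital associative algebra,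 and with a degree $0$ linear map $\varsigma:\Omega\to\Omega$ such that $m\circ(\varsigma\otimes1)\circ\Delta=u\circ\epsilon=m\circ(1\otimes\varsigma)\circ\Delta$. **The homotopy category.** A *homotopy pair* on $\mathrm{Hom}_{ccdgC}(C,D)$ is a pair $(f(t),\xi(t))$ of polynomials in $t$ whose coefficients are linear maps $C\to D$ of degree $0$ and $1$ respectively, such that $\frac{d}{dt}f(t)=\partial\xi(t)$, $f(0)$ is a morphism of ccdg-coalgebras, $\epsilon\circ\xi(t)=0$, and $\Delta\circ\xi(t)=(f(t)\otimes\xi(t)+\xi(t)\otimes f(t))\circ\Delta$. It connects $f(0)$ to $f(1)$. Let $\mathit{ho}\,ccdgC(\Bbbk)$ be the category whose objects are the ccdg-coalgebras over $\Bbbk$ and whose morphisms are the homotopy types of morphisms, i.e. the classes for the equivalence relation generated by "connected by a homotopy pair". For a ccdg-Hopf algebra $\Omega$ let $\mathfrak P_\Omega$ be the presheaf of groups on $\mathit{ho}\,ccdgC(\Bbbk)$ with $\mathfrak P_\Omega(C)=\mathrm{Hom}_{\mathit{ho}\,ccdgC(\Bbbk)}(C,\Omega)$, with product $[g_1][g_2]=[m\circ(g_1\otimes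 g_2)\circ\Delta]$, unit $[u\circ\epsilon]$, inverse $[g]^{-1}=[\varsigma\circ g]$, and with restriction $[g]\mapsto[g\circ f]$ along $[f]$. **Modules.** A *left dg-module* over $\Omega$ is a chain complex $M$ with a degree $0$ chain map $\gamma_M:\Omega\otimes M\to M$ that is a unital associative action. A morphism of degree $m$ from $M$ to $M'$ is a linear map $\psi$ of degree $m$, not necessarily a cycle, with $\psi\circ\gamma_M=\gamma_{M'}\circ(1\otimes\psi)$. The tensor product $M\otimes M'$ has the action $(\gamma_M\otimes\gamma_{M'})\circ(1\otimes\tau\otimes1)\circ(\Delta\otimes1)$; the unit object is $\Bbbk$ with the action given by $\epsilon$. Let $\omega$ be the forgetful dg-tensor functor from left dg-modules over $\Omega$ to chain complexes. **Tensor natural endomorphisms.** Let $C$ be a ccdg-coalgebra. An element $\eta$ of $\mathsf{End}(C\otimes\omega)_n$ is a family of linear maps $\eta_M:C\otimes M\to C\otimes M$ of degree $n$, one for each left dg-module $M$ over $\Omega$, which are maps of left $C$-comodules, $(\Delta\otimes1)\circ\eta_M=(1\otimes\eta_M)\circ(\Delta\otimes1)$, and which are natural: $(1\otimes\psi)\circ\eta_M=(-1)^{mn}\eta_{M'}\circ(1\otimes\psi)$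 for every morphism $\psi:M\to M'$ of every degree $m$. Put $(\delta\eta)_M=\partial\eta_M$. For $\varphi:C\otimes M\to C\otimes N$ put $\check{\mathfrak q}(\varphi)=(\epsilon\otimes1)\circ\varphi:C\otimes M\to N$, and for endomorphisms $\varphi$ of $C\otimes M$ and $\varphi'$ of $C\otimes M'$ put $$\varphi\otimes_\Delta\varphi'=(\varphi\otimes\check{\mathfrak q}(\varphi'))\circ(1\otimes\tau\otimes1)\circ(\Delta\otimes1):\;C\otimes M\otimes M'\to C\otimes M\otimes M'.$$ Let $Z_0\mathsf{End}^\otimes(C\otimes\omega)$ be the set of all $\eta\in\mathsf{End}(C\otimes\omega)_0$ with $\delta\eta=0$, $\eta_\Bbbk=1$, and $\eta_{M\otimes M'}=\eta_M\otimes_\Delta\eta_{M'}$ for all $M,M'$. A homotopy pair on it is a pair of polynomials $\eta(t)$, $\lambda(t)$ in $t$ with coefficients in $\mathsf{End}(C\otimes\omega)_0$ and $\mathsf{End}(C\otimes\omega)_1$ respectively, such that $\frac{d}{dt}\eta(t)=\delta\lambda(t)$, $\eta(0)\in Z_0\mathsf{End}^\otimes(C\otimes\omega)$, $\lambda(t)_\Bbbk=0$,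 and $\lambda(t)_{M\otimes M'}=\lambda(t)_M\otimes_\Delta\eta(t)_{M'}+\eta(t)_M\otimes_\Delta\lambda(t)_{M'}$ for all $M,M'$; it connects $\eta(0)$ to $\eta(1)$. Homotopy types are the classes for the equivalence relation generated by being connected by a homotopy pair. Let $\mathfrak P^\otimes_\omega$ be the presheaf of groups on $\mathit{ho}\,ccdgC(\Bbbk)$ for which $\mathfrak P^\otimes_\omega(C)$ is the set of homotopy types of elements of $Z_0\mathsf{End}^\otimes(C\otimes\omega)$, with product $[\eta'][\eta]=[\eta'\circ\eta]$ and unit $[1]$, and for which the restriction of $[\eta]\in\mathfrak P^\otimes_\omega(C')$ along $[f]$, for a morphism $f:C\to C'$, is the homotopy type of the family $\bigl(1\otimes\bigl(\check{\mathfrak q}(\eta_M)\circ(f\otimes1)\bigr)\bigr)\circ(\Delta\otimes1):C\otimes M\to C\otimes M$. **Theorem.** For every ccdg-Hopf algebra $\Omega$ over $\Bbbk$ there is a natural isomorphism of presheaves of groups $$\mathfrak P^\otimes_\omega\;\cong\;\mathfrak P_\Omega\;:\;\mathit{ho}\,ccdgC(\Bbbk)^{\mathrm{op}}\longrightarrow\mathrm{Grp}.$$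 Consequently $\mathfrak P^\otimes_\omega$ is representable, and through this isomorphism it is represented by $\Omega$. -/

import Mathlib

open CategoryTheory
open scoped TensorProduct

universe u

set_option linter.unusedSectionVars false
set_option linter.unusedSimpArgs false

namespace DGTannaka

/-- A chain complex over `k`, presented as a vector space `V` with an internal direct sum
decomposition `V = ⨁ n : ℤ, gr n` and a differential `d` of degree `-1` with `d ∘ d = 0`. -/
class DGSpace (k V : Type u) [Field k] [AddCommGroup V] [Module k V] where
  gr : ℤ → Submodule k V
  isInternal : DirectSum.IsInternal gr
  d : V →ₗ[k] V
  d_mem : ∀ {n : ℤ} {x : V}, x ∈ gr n → d x ∈ gr (n - 1)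
  d_d : ∀ x : V, d (d x) = 0

section Basic

variable {k : Type u} [Field k]
variable {V W X V₁ W₁ V₂ W₂ : Type u}
  [AddCommGroup V] [Module k V] [DGSpace k V]
  [AddCommGroup W] [Module k W] [DGSpace k W]
  [AddCommMonoid X] [Module k X]
  [AddCommGroup V₁] [Module k V₁] [DGSpace k V₁]
  [AddCommGroup W₁] [Module k W₁] [DGSpace k W₁]
  [AddCommGroup V₂] [Module k V₂] [DGSpace k V₂]
  [AddCommGroup W₂] [Module k W₂] [DGSpace k W₂]

variable (k V) in
/-- The homogeneous elements of degree `n`. -/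
abbrev gr (n : ℤ) : Submodule k V := DGSpace.gr n

variable (k V) in
/-- The differential. -/
abbrev dif : V →ₗ[k] V := DGSpace.d

theorem dif_dif (x : V) : dif k V (dif k V x) = 0 := DGSpace.d_d x

theorem dif_mem {n : ℤ} {x : V} (hx : x ∈ gr k V n) : dif k V x ∈ gr k V (n - 1) :=
  DGSpace.d_mem hx

variable (k V) in
/-- The decomposition into homogeneous components. -/
noncomputable def dec : V ≃ₗ[k] DirectSum ℤ (fun n => gr k V n) :=
  (LinearEquiv.ofBijective (DirectSum.coeLinearMap (gr k V)) DGSpace.isInternal).symm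

theorem dec_of_mem {n : ℤ} {x : V} (hx : x ∈ gr k V n) :
    dec k V x = DirectSum.lof k ℤ (fun n => gr k V n) n ⟨x, hx⟩ := by
  rw [dec, LinearEquiv.symm_apply_eq]
  exact (DirectSum.coeLinearMap_lof (gr k V) n ⟨x, hx⟩).symm

/-- The linear map with prescribed restrictions to the homogeneous components. -/
noncomputable def liftGr (F : ∀ n : ℤ, gr k V n →ₗ[k] X) : V →ₗ[k] X :=
  DirectSum.toModule k ℤ X F ∘ₗ (dec k V).toLinearMap

theorem liftGr_apply (F : ∀ n : ℤ, gr k V n →ₗ[k] X) {n : ℤ} {x : V} (hx : x ∈ gr k V n) :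
    liftGr F x = F n ⟨x, hx⟩ := by
  simp [liftGr, dec_of_mem hx]

theorem gr_span : ∀ x : V, x ∈ Submodule.span k {y : V | ∃ n, y ∈ gr k V n} := by
  intro x
  have h : x ∈ ⨆ n, gr k V n := by
    rw [(DGSpace.isInternal (k := k) (V := V)).submodule_iSup_eq_top]; trivial
  refine (iSup_le fun n => ?_ : (⨆ n, gr k V n) ≤ _) h
  exact fun y hy => Submodule.subset_span ⟨n, hy⟩

theorem hom_ext_gr {f g : V →ₗ[k] X} (h : ∀ n, ∀ x ∈ gr k V n, f x = g x) : f = g := by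
  ext x
  refine Submodule.span_induction (p := fun x _ => f x = g x) ?_ ?_ ?_ ?_ (gr_span (k := k) x)
  · rintro y ⟨n, hy⟩; exact h n y hy
  · simp
  · intro a b _ _ ha hb; simp [ha, hb]
  · intro c a _ ha; simp [ha]

theorem tensor_ext_gr {f g : V ⊗[k] W →ₗ[k] X}
    (h : ∀ i j, ∀ x ∈ gr k V i, ∀ y ∈ gr k W j, f (x ⊗ₜ y) = g (x ⊗ₜ y)) : f = g := by
  refine TensorProduct.ext ?_
  refine hom_ext_gr fun i x hx => hom_ext_gr fun j y hy => ?_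
  exact h i j x hx y hy

/-- The Koszul sign map `x ↦ (-1) ^ (n * |x|) x`. -/
noncomputable def kos (n : ℤ) : V →ₗ[k] V :=
  liftGr fun i => ((-1 : k) ^ (n * i)) • (gr k V i).subtype

theorem kos_apply (n : ℤ) {i : ℤ} {x : V} (hx : x ∈ gr k V i) :
    kos (k := k) n x = ((-1 : k) ^ (n * i)) • x := by
  simp [kos, liftGr_apply _ hx]

theorem kos_mem (n : ℤ) {i : ℤ} {x : V} (hx : x ∈ gr k V i) : kos (k := k) n x ∈ gr k V i := by
  rw [kos_apply n hx]; exact Submodule.smul_mem _ _ hx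

@[simp] theorem kos_zero : kos (k := k) (V := V) 0 = LinearMap.id :=
  hom_ext_gr fun i x hx => by simp [kos_apply 0 hx]

theorem sgn_congr {a b : ℤ} (h : Even (a - b)) : (-1 : k) ^ a = (-1 : k) ^ b := by
  have : a = (a - b) + b := by ring
  rw [this, zpow_add₀ (by simp), h.neg_one_zpow, one_mul]

/-- The tensor product `f ⊗ g` of graded maps, where `n` is the degree of `g`:
`(f ⊗ g) (x ⊗ y) = (-1) ^ (n * |x|) f x ⊗ g y`. -/
noncomputable def tmap (n : ℤ) (f : V →ₗ[k] V₁) (g : W →ₗ[k] W₁) :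
    V ⊗[k] W →ₗ[k] V₁ ⊗[k] W₁ :=
  TensorProduct.map (f ∘ₗ kos n) g

theorem tmap_tmul {k V W V₁ W₁ : Type u} [Field k] [AddCommGroup V] [Module k V] [DGSpace k V]
    [AddCommGroup W] [Module k W] [AddCommGroup V₁] [Module k V₁] [AddCommGroup W₁] [Module k W₁]
    (n : ℤ) (f : V →ₗ[k] V₁) (g : W →ₗ[k] W₁) {i : ℤ} {x : V}
    (hx : x ∈ gr k V i) (y : W) :
    tmap n f g (x ⊗ₜ y) = ((-1 : k) ^ (n * i)) • (f x ⊗ₜ[k] g y) := by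
  simp [tmap, kos_apply n hx, TensorProduct.smul_tmul']

theorem tmap_zero_deg {k V W V₁ W₁ : Type u} [Field k] [AddCommGroup V] [Module k V]
    [DGSpace k V] [AddCommGroup W] [Module k W] [AddCommGroup V₁] [Module k V₁]
    [AddCommGroup W₁] [Module k W₁] (f : V →ₗ[k] V₁) (g : W →ₗ[k] W₁) : tmap 0 f g = TensorProduct.map f g := by
  simp [tmap]

variable (k V W) in
/-- The degree `n` part of `V ⊗ W`, spanned by the `x ⊗ y` with `|x| + |y| = n`. -/
def tgr (n : ℤ) : Submodule k (V ⊗[k] W) :=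
  Submodule.span k {w | ∃ i j : ℤ, i + j = n ∧ ∃ x ∈ gr k V i, ∃ y ∈ gr k W j, w = x ⊗ₜ[k] y}

theorem tmul_mem_tgr {n i j : ℤ} (h : i + j = n) {x : V} (hx : x ∈ gr k V i) {y : W}
    (hy : y ∈ gr k W j) : x ⊗ₜ[k] y ∈ tgr k V W n :=
  Submodule.subset_span ⟨i, j, h, x, hx, y, hy, rfl⟩

theorem tgr_le {n : ℤ} {p : Submodule k X} (f : V ⊗[k] W →ₗ[k] X)
    (h : ∀ i j, i + j = n → ∀ x ∈ gr k V i, ∀ y ∈ gr k W j, f (x ⊗ₜ y) ∈ p) :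
    ∀ w ∈ tgr k V W n, f w ∈ p := by
  intro w hw
  refine (Submodule.span_le.2 ?_ : tgr k V W n ≤ p.comap f) hw
  rintro _ ⟨i, j, hij, x, hx, y, hy, rfl⟩
  exact h i j hij x hx y hy

theorem exists_repr {n : ℤ} {w : V ⊗[k] W} (hw : w ∈ tgr k V W n) :
    ∃ (N : ℕ) (i j : Fin N → ℤ) (x : Fin N → V) (y : Fin N → W),
      (∀ a, i a + j a = n) ∧ (∀ a, x a ∈ gr k V (i a)) ∧ (∀ a, y a ∈ gr k W (j a)) ∧
      w = ∑ a, x a ⊗ₜ[k] y a := by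
  obtain ⟨N, c, g, hg⟩ := Submodule.mem_span_set'.1 hw
  choose i j hij x hx y hy hxy using fun a => (g a).2
  refine ⟨N, i, j, fun a => c a • x a, y, hij, fun a => Submodule.smul_mem _ _ (hx a), hy, ?_⟩
  rw [← hg]
  refine Finset.sum_congr rfl fun a _ => ?_
  rw [hxy, TensorProduct.smul_tmul']

variable (k V W) in
/-- Auxiliary inverse, used to see that the grading of `V ⊗ W` is an internal decomposition. -/
noncomputable def tdec : V ⊗[k] W →ₗ[k] DirectSum ℤ (fun n => tgr k V W n) :=
  TensorProduct.lift (liftGr fun i => LinearMap.flip (liftGr fun j => LinearMap.flip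
    (LinearMap.mk₂ k (fun (x : gr k V i) (y : gr k W j) =>
      DirectSum.lof k ℤ (fun n => tgr k V W n) (i + j) ⟨x.1 ⊗ₜ[k] y.1, tmul_mem_tgr rfl x.2 y.2⟩)
      (fun x x' y => by rw [← map_add]; congr 1; ext; simp [TensorProduct.add_tmul])
      (fun c x y => by rw [← map_smul]; congr 1)
      (fun x y y' => by rw [← map_add]; congr 1; ext; simp [TensorProduct.tmul_add])
      (fun c x y => by rw [← map_smul]; congr 1; ext; simp))))

theorem tdec_tmul {i j : ℤ} {x : V} (hx : x ∈ gr k V i) {y : W} (hy : y ∈ gr k W j) :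
    tdec k V W (x ⊗ₜ y) = DirectSum.lof k ℤ (fun n => tgr k V W n) (i + j)
      ⟨x ⊗ₜ[k] y, tmul_mem_tgr rfl hx hy⟩ := by
  simp [tdec, liftGr_apply _ hx, liftGr_apply _ hy]

theorem tgr_isInternal : DirectSum.IsInternal (tgr k V W) := by
  have h1 : DirectSum.coeLinearMap (tgr k V W) ∘ₗ tdec k V W = LinearMap.id :=
    tensor_ext_gr fun i j x hx y hy => by simp [tdec_tmul hx hy]
  have h2 : tdec k V W ∘ₗ DirectSum.coeLinearMap (tgr k V W) = LinearMap.id := by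
    refine DirectSum.linearMap_ext k fun n => ?_
    ext1 ⟨w, hw⟩
    simp only [LinearMap.comp_apply, DirectSum.coeLinearMap_lof, LinearMap.id_apply]
    refine Submodule.span_induction (p := fun w hw => tdec k V W w =
      DirectSum.lof k ℤ (fun n => tgr k V W n) n ⟨w, hw⟩) ?_ ?_ ?_ ?_ hw
    · rintro _ ⟨i, j, rfl, x, hx, y, hy, rfl⟩
      exact tdec_tmul hx hy
    · rw [map_zero]; symm; exact map_zero _
    · intro a b ha hb h h'
      rw [map_add, h, h', ← map_add]; rfl
    · intro c a ha h
      rw [map_smul, h, ← map_smul]; rfl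
  constructor
  · intro a b hab
    have := congrArg (tdec k V W) hab
    exact (LinearMap.congr_fun h2 a).symm.trans (this.trans (LinearMap.congr_fun h2 b))
  · intro w
    exact ⟨tdec k V W w, LinearMap.congr_fun h1 w⟩

variable (k V W) in
/-- The differential `∂ ⊗ 1 + 1 ⊗ ∂` of `V ⊗ W`. -/
noncomputable def tdif : V ⊗[k] W →ₗ[k] V ⊗[k] W :=
  tmap 0 (dif k V) LinearMap.id + tmap (-1) LinearMap.id (dif k W)

theorem tdif_tmul {i : ℤ} {x : V} (hx : x ∈ gr k V i) (y : W) :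
    tdif k V W (x ⊗ₜ y) = dif k V x ⊗ₜ y + ((-1 : k) ^ i) • (x ⊗ₜ[k] dif k W y) := by
  rw [tdif, LinearMap.add_apply, tmap_tmul 0 _ _ hx, tmap_tmul (-1) _ _ hx]
  congr 1
  · simp
  · rw [sgn_congr (b := i) ⟨-i, by ring⟩]
    rfl

/-- The tensor product of chain complexes. -/
noncomputable instance instDGTensor : DGSpace k (V ⊗[k] W) where
  gr := tgr k V W
  isInternal := tgr_isInternal
  d := tdif k V W
  d_mem {n w} hw := by
    refine tgr_le (tdif k V W) (fun i j hij x hx y hy => ?_) w hw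
    rw [tdif_tmul hx]
    refine Submodule.add_mem _ ?_ (Submodule.smul_mem _ _ ?_)
    · exact tmul_mem_tgr (by omega) (dif_mem hx) hy
    · exact tmul_mem_tgr (by omega) hx (dif_mem hy)
  d_d w := by
    have : tdif k V W ∘ₗ tdif k V W = 0 := tensor_ext_gr fun i j x hx y hy => by
      simp only [LinearMap.comp_apply, tdif_tmul hx, map_add, map_smul, tdif_tmul (dif_mem hx),
        dif_dif, TensorProduct.zero_tmul, TensorProduct.tmul_zero, smul_zero, zero_add, add_zero,
        LinearMap.zero_apply, ← add_smul]
      have h : (-1 : k) ^ (i - 1) + (-1 : k) ^ i = 0 := by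
        rw [zpow_sub₀ (by simp)]; simp [div_neg]
      rw [h, zero_smul]
    exact LinearMap.congr_fun this w

/-- The ground field as a chain complex concentrated in degree `0`. -/
noncomputable instance instDGField : DGSpace k k where
  gr n := if n = 0 then ⊤ else ⊥
  isInternal := by
    rw [DirectSum.isInternal_submodule_iff_iSupIndep_and_iSup_eq_top]
    constructor
    · intro n
      by_cases hn : n = 0
      · subst hn
        rw [disjoint_iff, eq_bot_iff]
        have : (⨆ (j : ℤ) (_ : j ≠ 0), (if j = 0 then ⊤ else ⊥ : Submodule k k)) = ⊥ := by
          simp only [iSup_eq_bot]; intro j hj; simp [hj]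
        rw [this]; simp
      · simp [hn]
    · rw [eq_top_iff]; exact le_trans (by simp) (le_iSup _ (0 : ℤ))
  d := 0
  d_mem _ := by simp
  d_d _ := by simp

theorem gr_tensor (n : ℤ) : gr k (V ⊗[k] W) n = tgr k V W n := rfl

theorem dif_tensor : dif k (V ⊗[k] W) = tdif k V W := rfl

theorem dif_field : dif k k = 0 := rfl

theorem mem_gr_field (a : k) : a ∈ gr k k 0 := by
  change a ∈ (if (0 : ℤ) = 0 then ⊤ else ⊥ : Submodule k k); simp

theorem gr_field_ne {n : ℤ} (hn : n ≠ 0) {a : k} (ha : a ∈ gr k k n) : a = 0 := by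
  change a ∈ (if n = 0 then ⊤ else ⊥ : Submodule k k) at ha; simpa [hn] using ha

theorem tmul_mem {n i j : ℤ} (h : i + j = n) {x : V} (hx : x ∈ gr k V i) {y : W}
    (hy : y ∈ gr k W j) : x ⊗ₜ[k] y ∈ gr k (V ⊗[k] W) n := tmul_mem_tgr h hx hy

variable (k V W) in
/-- The symmetry `τ (x ⊗ y) = (-1) ^ (|x| * |y|) y ⊗ x`. -/
noncomputable def swap : V ⊗[k] W →ₗ[k] W ⊗[k] V :=
  TensorProduct.lift (liftGr fun i =>
    (LinearMap.lcomp k (W ⊗[k] V) (kos (k := k) (V := W) i) ∘ₗ (TensorProduct.mk k W V).flip) ∘ₗ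
      (gr k V i).subtype)

theorem swap_tmul {i j : ℤ} {x : V} (hx : x ∈ gr k V i) {y : W} (hy : y ∈ gr k W j) :
    swap k V W (x ⊗ₜ y) = ((-1 : k) ^ (i * j)) • (y ⊗ₜ[k] x) := by
  simp [swap, liftGr_apply _ hx, kos_apply i hy, TensorProduct.smul_tmul']

variable (k V W V₁ W₁) in
/-- The map `1 ⊗ τ ⊗ 1`. -/
noncomputable def midSwap : (V ⊗[k] V₁) ⊗[k] (W ⊗[k] W₁) →ₗ[k] (V ⊗[k] W) ⊗[k] (V₁ ⊗[k] W₁) :=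
  (TensorProduct.assoc k V W (V₁ ⊗[k] W₁)).symm.toLinearMap ∘ₗ
    (LinearMap.lTensor V ((TensorProduct.assoc k W V₁ W₁).toLinearMap ∘ₗ
      (LinearMap.rTensor W₁ (swap k V₁ W)) ∘ₗ
      (TensorProduct.assoc k V₁ W W₁).symm.toLinearMap)) ∘ₗ
    (TensorProduct.assoc k V V₁ (W ⊗[k] W₁)).toLinearMap

theorem midSwap_tmul {k V W V₁ W₁ : Type u} [Field k] [AddCommGroup V] [Module k V]
    [AddCommGroup W] [Module k W] [DGSpace k W] [AddCommGroup V₁] [Module k V₁] [DGSpace k V₁]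
    [AddCommGroup W₁] [Module k W₁] {i j : ℤ} (x : V) {x' : V₁} (hx' : x' ∈ gr k V₁ i) {y : W}
    (hy : y ∈ gr k W j) (y' : W₁) :
    midSwap k V W V₁ W₁ ((x ⊗ₜ x') ⊗ₜ (y ⊗ₜ y')) =
      ((-1 : k) ^ (i * j)) • ((x ⊗ₜ[k] y) ⊗ₜ[k] (x' ⊗ₜ[k] y')) := by
  simp [midSwap, swap_tmul hx' hy, TensorProduct.smul_tmul']

variable (k V W) in
/-- Linear maps of degree `n`. -/
def homDeg (n : ℤ) : Submodule k (V →ₗ[k] W) where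
  carrier := {f | ∀ i, ∀ x ∈ gr k V i, f x ∈ gr k W (i + n)}
  zero_mem' := by intro i x _; simp
  add_mem' := by intro f g hf hg i x hx; exact Submodule.add_mem _ (hf i x hx) (hg i x hx)
  smul_mem' := by intro c f hf i x hx; exact Submodule.smul_mem _ _ (hf i x hx)

/-- The differential `∂ ∘ f - (-1) ^ n f ∘ ∂` of a map `f` of degree `n`. -/
noncomputable def homDif (n : ℤ) (f : V →ₗ[k] W) : V →ₗ[k] W :=
  dif k W ∘ₗ f - ((-1 : k) ^ n) • (f ∘ₗ dif k V)

end Basic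

section Calculus

variable {k : Type u} [Field k]
variable {V V' V₁ V₂ V₃ : Type u}
  [AddCommGroup V] [Module k V] [DGSpace k V]
  [AddCommGroup V'] [Module k V'] [DGSpace k V']
  [AddCommGroup V₁] [Module k V₁] [DGSpace k V₁]
  [AddCommGroup V₂] [Module k V₂] [DGSpace k V₂]
  [AddCommGroup V₃] [Module k V₃] [DGSpace k V₃]
variable {A B P Q : Type u}
  [AddCommGroup A] [Module k A]
  [AddCommGroup B] [Module k B]
  [AddCommGroup P] [Module k P]
  [AddCommGroup Q] [Module k Q]

theorem map_comp_tmap {A' B' : Type u} [AddCommGroup A'] [Module k A'] [AddCommGroup B']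
    [Module k B'] (n : ℤ) (f : A →ₗ[k] A') (g : B →ₗ[k] B') (a : V →ₗ[k] A) (b : P →ₗ[k] B) :
    TensorProduct.map f g ∘ₗ tmap n a b = tmap n (f ∘ₗ a) (g ∘ₗ b) := by
  simp only [tmap, ← TensorProduct.map_comp, LinearMap.comp_assoc]

theorem kos_comp {n : ℤ} {f : V →ₗ[k] V'} {p : ℤ} (hf : f ∈ homDeg k V V' p) :
    kos n ∘ₗ f = ((-1 : k) ^ (n * p)) • (f ∘ₗ kos n) := by
  refine hom_ext_gr fun i x hx => ?_
  simp only [LinearMap.comp_apply, LinearMap.smul_apply, kos_apply n hx, kos_apply n (hf i x hx),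
    map_smul, smul_smul]
  rw [← zpow_add₀ (by simp)]
  congr 2; ring

theorem kos_comp_zero {n : ℤ} {f : V →ₗ[k] V'} (hf : f ∈ homDeg k V V' 0) :
    kos n ∘ₗ f = f ∘ₗ kos n := by
  simp [kos_comp hf]

theorem kos_kos (m n : ℤ) : kos (k := k) (V := V) m ∘ₗ kos n = kos (m + n) := by
  refine hom_ext_gr fun i x hx => ?_
  simp only [LinearMap.comp_apply, kos_apply n hx, map_smul, kos_apply m hx, smul_smul,
    kos_apply (m + n) hx]
  rw [← zpow_add₀ (by simp)]
  congr 2; ring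

theorem tmap_comp_map (n : ℤ) {f : V →ₗ[k] V'} (hf : f ∈ homDeg k V V' 0) (g : P →ₗ[k] Q)
    (a : V' →ₗ[k] A) (b : Q →ₗ[k] B) :
    tmap n a b ∘ₗ TensorProduct.map f g = tmap n (a ∘ₗ f) (b ∘ₗ g) := by
  simp only [tmap, ← TensorProduct.map_comp, LinearMap.comp_assoc, kos_comp_zero hf]

theorem tmap_comp_tmap_id (n m : ℤ) (a : V →ₗ[k] A) (b : Q →ₗ[k] B) (g : P →ₗ[k] Q) :
    tmap n a b ∘ₗ tmap m LinearMap.id g = tmap (n + m) a (b ∘ₗ g) := by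
  simp only [tmap, ← TensorProduct.map_comp, LinearMap.comp_assoc, LinearMap.id_comp, kos_kos]

theorem tmap_id_comp_map (n p : ℤ) {f : V →ₗ[k] V'} (hf : f ∈ homDeg k V V' p) (g : P →ₗ[k] Q)
    (b : Q →ₗ[k] B) :
    tmap n LinearMap.id b ∘ₗ TensorProduct.map f g = ((-1 : k) ^ (n * p)) • tmap n f (b ∘ₗ g) := by
  simp only [tmap, ← TensorProduct.map_comp, LinearMap.id_comp, kos_comp hf,
    TensorProduct.map_smul_left]

theorem assoc_tmap (q r : ℤ) {a : V →ₗ[k] A} {b : V' →ₗ[k] B} (c : P →ₗ[k] Q) :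
    (TensorProduct.assoc k A B Q).toLinearMap ∘ₗ tmap r (tmap q a b) c =
      tmap (q + r) a (tmap r b c) ∘ₗ (TensorProduct.assoc k V V' P).toLinearMap := by
  refine TensorProduct.ext (tensor_ext_gr fun i j x hx y hy => LinearMap.ext fun z => ?_)
  change (TensorProduct.assoc k A B Q) (tmap r (tmap q a b) c ((x ⊗ₜ y) ⊗ₜ z)) =
    tmap (q + r) a (tmap r b c) (x ⊗ₜ (y ⊗ₜ z))
  simp only [TensorProduct.assoc_tmul, tmap_tmul _ _ _ hx,
    tmap_tmul _ _ _ (tmul_mem rfl hx hy), tmap_tmul _ _ _ hy, TensorProduct.tmul_smul, map_smul,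
    ← TensorProduct.smul_tmul', smul_smul, ← zpow_add₀ (show (-1 : k) ≠ 0 by simp)]
  congr 2; ring

theorem tmap_deg (p q n : ℤ) {a : V →ₗ[k] V₁} {b : V' →ₗ[k] V₂} (ha : a ∈ homDeg k V V₁ p)
    (hb : b ∈ homDeg k V' V₂ q) :
    tmap n a b ∈ homDeg k (V ⊗[k] V') (V₁ ⊗[k] V₂) (p + q) := by
  intro i w hw
  refine tgr_le (tmap n a b) (fun i j hij x hx y hy => ?_) w hw
  rw [tmap_tmul _ _ _ hx]
  exact Submodule.smul_mem _ _ (tmul_mem (by omega) (ha _ _ hx) (hb _ _ hy))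

theorem map_deg {a : V →ₗ[k] V₁} {b : V' →ₗ[k] V₂} (ha : a ∈ homDeg k V V₁ 0)
    (hb : b ∈ homDeg k V' V₂ 0) :
    TensorProduct.map a b ∈ homDeg k (V ⊗[k] V') (V₁ ⊗[k] V₂) 0 := by
  rw [← tmap_zero_deg]; exact tmap_deg 0 0 0 ha hb

theorem id_deg : LinearMap.id ∈ homDeg k V V 0 := by
  intro i x hx; rw [add_zero]; exact hx

theorem comp_deg {p q r : ℤ} (h : p + q = r) {a : V →ₗ[k] V₁} {b : V₁ →ₗ[k] V₂}
    (ha : a ∈ homDeg k V V₁ p) (hb : b ∈ homDeg k V₁ V₂ q) : b ∘ₗ a ∈ homDeg k V V₂ r := by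
  intro i x hx
  have := hb _ _ (ha i x hx)
  rwa [add_assoc, h] at this

theorem assoc_deg : (TensorProduct.assoc k V V₁ V₂).toLinearMap ∈
    homDeg k ((V ⊗[k] V₁) ⊗[k] V₂) (V ⊗[k] (V₁ ⊗[k] V₂)) 0 := by
  intro n w hw
  refine tgr_le _ (fun i j hij x hx y hy => ?_) w hw
  refine tgr_le ((TensorProduct.assoc k V V₁ V₂).toLinearMap ∘ₗ
    (TensorProduct.mk k (V ⊗[k] V₁) V₂).flip y) (fun i' j' hij' x' hx' y' hy' => ?_) x hx
  simp only [LinearMap.comp_apply, LinearMap.flip_apply, TensorProduct.mk_apply,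
    LinearEquiv.coe_coe, TensorProduct.assoc_tmul]
  exact tmul_mem (by omega) hx' (tmul_mem rfl hy' hy)

theorem midSwap_deg : midSwap k V V₁ V₂ V₃ ∈
    homDeg k ((V ⊗[k] V₂) ⊗[k] (V₁ ⊗[k] V₃)) ((V ⊗[k] V₁) ⊗[k] (V₂ ⊗[k] V₃)) 0 := by
  intro n w hw
  refine tgr_le _ (fun i j hij x hx y hy => ?_) w hw
  refine tgr_le (midSwap k V V₁ V₂ V₃ ∘ₗ
    (TensorProduct.mk k (V ⊗[k] V₂) (V₁ ⊗[k] V₃)).flip y) (fun i' j' hij' x' hx' y' hy' => ?_) x hx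
  refine tgr_le (midSwap k V V₁ V₂ V₃ ∘ₗ (TensorProduct.mk k (V ⊗[k] V₂) (V₁ ⊗[k] V₃) (x' ⊗ₜ y')))
    (fun i'' j'' hij'' x'' hx'' y'' hy'' => ?_) y hy
  simp only [LinearMap.comp_apply, TensorProduct.mk_apply, midSwap_tmul _ hy' hx'']
  exact Submodule.smul_mem _ _
    (tmul_mem (by omega) (tmul_mem rfl hx' hx'') (tmul_mem rfl hy' hy''))

theorem tensor4_ext {X : Type u} [AddCommGroup X] [Module k X]
    {f g : (V ⊗[k] V₁) ⊗[k] (V₂ ⊗[k] V₃) →ₗ[k] X}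
    (h : ∀ i₀ i₁ i₂ i₃, ∀ x₀ ∈ gr k V i₀, ∀ x₁ ∈ gr k V₁ i₁, ∀ x₂ ∈ gr k V₂ i₂, ∀ x₃ ∈ gr k V₃ i₃,
      f ((x₀ ⊗ₜ x₁) ⊗ₜ (x₂ ⊗ₜ x₃)) = g ((x₀ ⊗ₜ x₁) ⊗ₜ (x₂ ⊗ₜ x₃))) : f = g := by
  refine TensorProduct.ext (tensor_ext_gr fun i₀ i₁ x₀ h₀ x₁ h₁ => ?_)
  exact tensor_ext_gr fun i₂ i₃ x₂ h₂ x₃ h₃ => h _ _ _ _ _ h₀ _ h₁ _ h₂ _ h₃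

theorem midSwap_tmap {W₁ W₂ : Type u} [AddCommGroup W₁] [Module k W₁] [DGSpace k W₁]
    [AddCommGroup W₂] [Module k W₂] [DGSpace k W₂] (p' q q' : ℤ)
    (a : V →ₗ[k] A) {a' : V₁ →ₗ[k] W₁} {b : V₂ →ₗ[k] W₂} (b' : V₃ →ₗ[k] B)
    (ha' : a' ∈ homDeg k V₁ W₁ p') (hb : b ∈ homDeg k V₂ W₂ q) :
    midSwap k A W₂ W₁ B ∘ₗ tmap (q + q') (tmap p' a a') (tmap q' b b') =
      ((-1 : k) ^ (p' * q)) • (tmap (p' + q') (tmap q a b) (tmap q' a' b') ∘ₗ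
        midSwap k V V₂ V₁ V₃) := by
  refine tensor4_ext fun i₀ i₁ i₂ i₃ x₀ h₀ x₁ h₁ x₂ h₂ x₃ h₃ => ?_
  simp only [LinearMap.comp_apply, LinearMap.smul_apply, midSwap_tmul _ h₁ h₂, map_smul,
    tmap_tmul _ _ _ (tmul_mem rfl h₀ h₁), tmap_tmul _ _ _ (tmul_mem rfl h₀ h₂),
    tmap_tmul _ _ _ h₀, tmap_tmul _ _ _ h₁, tmap_tmul _ _ _ h₂, TensorProduct.tmul_smul,
    ← TensorProduct.smul_tmul', midSwap_tmul _ (ha' _ _ h₁) (hb _ _ h₂), smul_smul,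
    ← zpow_add₀ (show (-1 : k) ≠ 0 by simp)]
  congr 1
  refine sgn_congr ⟨q * i₁, ?_⟩
  ring

/-- Maps commuting with the differentials. -/
def IsChain (f : V →ₗ[k] V') : Prop := dif k V' ∘ₗ f = f ∘ₗ dif k V

theorem IsChain.apply {f : V →ₗ[k] V'} (h : IsChain f) (x : V) : dif k V' (f x) = f (dif k V x) :=
  LinearMap.congr_fun h x

theorem IsChain.comp {f : V →ₗ[k] V₁} {g : V₁ →ₗ[k] V₂} (hg : IsChain g) (hf : IsChain f) :
    IsChain (g ∘ₗ f) := by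
  ext x; simp [hf.apply, hg.apply]

theorem isChain_id : IsChain (LinearMap.id : V →ₗ[k] V) := rfl

theorem homDif_tmap_left (n : ℤ) {a : V →ₗ[k] V₁} {b : V' →ₗ[k] V₂} (ha : a ∈ homDeg k V V₁ n)
    (hb : IsChain b) : homDif n (tmap 0 a b) = tmap 0 (homDif n a) b := by
  refine tensor_ext_gr fun i j x hx y hy => ?_
  simp only [homDif, LinearMap.sub_apply, LinearMap.smul_apply, LinearMap.comp_apply, dif_tensor,
    tmap_tmul _ _ _ hx, tdif_tmul hx, zero_mul, zpow_zero, one_smul, tdif_tmul (ha _ _ hx),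
    map_add, map_smul, tmap_tmul _ _ _ (dif_mem hx), hb.apply, TensorProduct.sub_tmul, smul_add,
    smul_smul, ← TensorProduct.smul_tmul', ← zpow_add₀ (show (-1 : k) ≠ 0 by simp)]
  rw [add_comm i n]; abel

theorem homDif_tmap_right (n : ℤ) {a : V →ₗ[k] V₁} {b : V' →ₗ[k] V₂} (ha : a ∈ homDeg k V V₁ 0)
    (hac : IsChain a) : homDif n (tmap n a b) = tmap (n - 1) a (homDif n b) := by
  refine tensor_ext_gr fun i j x hx y hy => ?_
  have hax : a x ∈ gr k V₁ i := by simpa using ha _ _ hx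
  simp only [homDif, LinearMap.sub_apply, LinearMap.smul_apply, LinearMap.comp_apply, dif_tensor,
    tmap_tmul _ _ _ hx, tdif_tmul hx, tdif_tmul hax,
    map_add, map_smul, tmap_tmul _ _ _ (dif_mem hx), hac.apply, TensorProduct.tmul_sub, smul_add,
    smul_sub, TensorProduct.tmul_smul,
    smul_smul, ← zpow_add₀ (show (-1 : k) ≠ 0 by simp)]
  have e1 : (-1 : k) ^ (n + n * (i - 1)) = (-1 : k) ^ (n * i) := by congr 1; ring
  have e2 : (-1 : k) ^ ((n - 1) * i) = (-1 : k) ^ (n * i + i) := sgn_congr ⟨-i, by ring⟩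
  have e3 : (-1 : k) ^ ((n - 1) * i + n) = (-1 : k) ^ (n + (i + n * i)) :=
    sgn_congr ⟨-i, by ring⟩
  rw [e1, e2, e3]; abel

theorem homDif_comp (n : ℤ) (a : V →ₗ[k] V₁) {f : V₁ →ₗ[k] V₂} {g : V' →ₗ[k] V}
    (hf : IsChain f) (hg : IsChain g) : homDif n (f ∘ₗ a ∘ₗ g) = f ∘ₗ homDif n a ∘ₗ g := by
  ext x; simp [homDif, hf.apply, hg.apply]

theorem homDif_comp_right (n : ℤ) (a : V →ₗ[k] V₁) {f : V' →ₗ[k] V} (hf : IsChain f) :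
    homDif n (a ∘ₗ f) = homDif n a ∘ₗ f := by
  simpa using homDif_comp n a isChain_id hf

theorem homDif_comp_left (n : ℤ) (a : V →ₗ[k] V₁) {f : V₁ →ₗ[k] V₂} (hf : IsChain f) :
    homDif n (f ∘ₗ a) = f ∘ₗ homDif n a := by
  simpa using homDif_comp n a hf isChain_id

theorem isChain_iff (f : V →ₗ[k] V') : IsChain f ↔ homDif 0 f = 0 := by
  simp [IsChain, homDif, sub_eq_zero]

theorem IsChain.map {a : V →ₗ[k] V₁} {b : V' →ₗ[k] V₂} (ha : a ∈ homDeg k V V₁ 0)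
    (hac : IsChain a) (hb : IsChain b) : IsChain (TensorProduct.map a b) := by
  rw [isChain_iff, ← tmap_zero_deg, homDif_tmap_left 0 ha hb, (isChain_iff a).1 hac]
  simp [tmap]

theorem tensor3_ext {X : Type u} [AddCommGroup X] [Module k X]
    {f g : (V ⊗[k] V₁) ⊗[k] V₂ →ₗ[k] X}
    (h : ∀ i₀ i₁ i₂, ∀ x₀ ∈ gr k V i₀, ∀ x₁ ∈ gr k V₁ i₁, ∀ x₂ ∈ gr k V₂ i₂,
      f ((x₀ ⊗ₜ x₁) ⊗ₜ x₂) = g ((x₀ ⊗ₜ x₁) ⊗ₜ x₂)) : f = g := by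
  refine TensorProduct.ext (tensor_ext_gr fun i₀ i₁ x₀ h₀ x₁ h₁ => ?_)
  exact hom_ext_gr fun i₂ x₂ h₂ => h _ _ _ _ h₀ _ h₁ _ h₂

theorem isChain_assoc : IsChain (TensorProduct.assoc k V V₁ V₂).toLinearMap := by
  refine tensor3_ext fun i j l x hx y hy z hz => ?_
  simp only [LinearMap.comp_apply,
    LinearEquiv.coe_coe, TensorProduct.assoc_tmul, dif_tensor, tdif_tmul hx, tdif_tmul hy,
    tdif_tmul (tmul_mem rfl hx hy), TensorProduct.tmul_add, TensorProduct.add_tmul, map_add,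
    map_smul, TensorProduct.tmul_smul, ← TensorProduct.smul_tmul', smul_add, smul_smul,
    ← zpow_add₀ (show (-1 : k) ≠ 0 by simp)]
  abel

theorem isChain_midSwap : IsChain (midSwap k V V₁ V₂ V₃) := by
  refine tensor4_ext fun i₀ i₁ i₂ i₃ x₀ h₀ x₁ h₁ x₂ h₂ x₃ h₃ => ?_
  simp only [LinearMap.comp_apply, dif_tensor, tdif_tmul h₀, tdif_tmul h₁, tdif_tmul h₂,
    tdif_tmul (tmul_mem rfl h₀ h₁), tdif_tmul (tmul_mem rfl h₀ h₂), midSwap_tmul _ h₁ h₂,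
    midSwap_tmul _ (dif_mem h₁) h₂, midSwap_tmul _ h₁ (dif_mem h₂),
    TensorProduct.tmul_add, TensorProduct.add_tmul, map_add,
    map_smul, TensorProduct.tmul_smul, ← TensorProduct.smul_tmul', smul_add, smul_smul,
    ← zpow_add₀ (show (-1 : k) ≠ 0 by simp)]
  have e1 : (-1 : k) ^ (i₁ * i₂ + i₀) = (-1 : k) ^ (i₀ + i₁ * i₂) := by congr 1; ring
  have e2 : (-1 : k) ^ (i₁ * i₂ + (i₀ + i₂)) = (-1 : k) ^ (i₀ + (i₁ - 1) * i₂) :=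
    sgn_congr ⟨i₂, by ring⟩
  have e3 : (-1 : k) ^ (i₀ + i₁ + i₁ * (i₂ - 1)) = (-1 : k) ^ (i₁ * i₂ + i₀) := by
    congr 1; ring
  have e4 : (-1 : k) ^ (i₁ * i₂ + (i₀ + i₂ + i₁)) = (-1 : k) ^ (i₀ + i₁ + (i₂ + i₁ * i₂)) := by
    congr 1; ring
  rw [e2, e3, e4]
  abel_nf

end Calculus

section Coalg

/-- Cocommutative dg-coalgebras: counit and comultiplication are chain maps of degree `0`, and the
comultiplication is cocommutative in the graded sense. Coassociativity and counitality are part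
of `Coalgebra`. -/
class IsCCDGCoalgebra (k C : Type u) [Field k] [AddCommGroup C] [Module k C] [DGSpace k C]
    [Coalgebra k C] : Prop where
  counit_deg : (Coalgebra.counit : C →ₗ[k] k) ∈ homDeg k C k 0
  comul_deg : (Coalgebra.comul : C →ₗ[k] C ⊗[k] C) ∈ homDeg k C (C ⊗[k] C) 0
  counit_chain : IsChain (Coalgebra.counit : C →ₗ[k] k)
  comul_chain : IsChain (Coalgebra.comul : C →ₗ[k] C ⊗[k] C)
  cocomm : swap k C C ∘ₗ Coalgebra.comul = (Coalgebra.comul : C →ₗ[k] C ⊗[k] C)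

/-- The structure of a ccdg-Hopf algebra on a ccdg-coalgebra: unit and multiplication are chain maps
of degree `0` and morphisms of coalgebras, and form a unital associative algebra; the antipode is a
linear map of degree `0`. -/
class CCDGHopfStr (k Ω : Type u) [Field k] [AddCommGroup Ω] [Module k Ω] [DGSpace k Ω]
    [Coalgebra k Ω] where
  one : k →ₗ[k] Ω
  mul : Ω ⊗[k] Ω →ₗ[k] Ω
  antipode : Ω →ₗ[k] Ω
  one_deg : one ∈ homDeg k k Ω 0
  mul_deg : mul ∈ homDeg k (Ω ⊗[k] Ω) Ω 0
  antipode_deg : antipode ∈ homDeg k Ω Ω 0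
  one_chain : IsChain one
  mul_chain : IsChain mul
  mul_assoc : mul ∘ₗ LinearMap.rTensor Ω mul =
    mul ∘ₗ LinearMap.lTensor Ω mul ∘ₗ (TensorProduct.assoc k Ω Ω Ω).toLinearMap
  one_mul : mul ∘ₗ LinearMap.rTensor Ω one = (TensorProduct.lid k Ω).toLinearMap
  mul_one : mul ∘ₗ LinearMap.lTensor Ω one = (TensorProduct.rid k Ω).toLinearMap
  counit_one : Coalgebra.counit ∘ₗ one = LinearMap.id
  comul_one : Coalgebra.comul ∘ₗ one =
    TensorProduct.map one one ∘ₗ (TensorProduct.lid k k).symm.toLinearMap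
  counit_mul : Coalgebra.counit ∘ₗ mul = (TensorProduct.lid k k).toLinearMap ∘ₗ
    TensorProduct.map Coalgebra.counit Coalgebra.counit
  comul_mul : Coalgebra.comul ∘ₗ mul = TensorProduct.map mul mul ∘ₗ midSwap k Ω Ω Ω Ω ∘ₗ
    TensorProduct.map Coalgebra.comul Coalgebra.comul
  antipode_left : mul ∘ₗ TensorProduct.map antipode LinearMap.id ∘ₗ Coalgebra.comul =
    one ∘ₗ Coalgebra.counit
  antipode_right : mul ∘ₗ TensorProduct.map LinearMap.id antipode ∘ₗ Coalgebra.comul =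
    one ∘ₗ Coalgebra.counit

variable (k C : Type u) [Field k] [AddCommGroup C] [Module k C] [Coalgebra k C]

/-- The counit. -/
abbrev cou : C →ₗ[k] k := Coalgebra.counit
/-- The comultiplication. -/
abbrev com : C →ₗ[k] C ⊗[k] C := Coalgebra.comul

end Coalg

section Conv

variable {k : Type u} [Field k]
variable {C : Type u} [AddCommGroup C] [Module k C] [DGSpace k C] [Coalgebra k C]
variable {P Q R S T U : Type u}
  [AddCommGroup P] [Module k P]
  [AddCommGroup Q] [Module k Q]
  [AddCommGroup R] [Module k R]
  [AddCommGroup S] [Module k S]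
  [AddCommGroup T] [Module k T]
  [AddCommGroup U] [Module k U]

/-- The map `μ ∘ (a ⊗ b) ∘ Δ`, where `n` is the degree of `b`. -/
noncomputable def cv (μ : P ⊗[k] Q →ₗ[k] R) (n : ℤ) (a : C →ₗ[k] P) (b : C →ₗ[k] Q) :
    C →ₗ[k] R := μ ∘ₗ tmap n a b ∘ₗ com k C

theorem cou_kos [IsCCDGCoalgebra k C] (n : ℤ) : cou k C ∘ₗ kos n = cou k C := by
  refine hom_ext_gr fun i x hx => ?_
  rw [LinearMap.comp_apply, kos_apply n hx, map_smul]
  by_cases h : i = 0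
  · subst h; simp
  · have := IsCCDGCoalgebra.counit_deg (k := k) (C := C) i x hx
    rw [gr_field_ne (by simpa using h) this, smul_zero]

theorem tmap_cou [IsCCDGCoalgebra k C] (n : ℤ) (f : k →ₗ[k] P) (b : Q →ₗ[k] R) :
    tmap n (f ∘ₗ cou k C) b = TensorProduct.map (f ∘ₗ cou k C) b := by
  rw [tmap, LinearMap.comp_assoc, cou_kos]

theorem cv_assoc [IsCCDGCoalgebra k C] {m₁ : S ⊗[k] R →ₗ[k] U} {m₂ : P ⊗[k] Q →ₗ[k] S}
    {m₃ : P ⊗[k] T →ₗ[k] U} {m₄ : Q ⊗[k] R →ₗ[k] T}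
    (h : m₁ ∘ₗ LinearMap.rTensor R m₂ =
      m₃ ∘ₗ LinearMap.lTensor P m₄ ∘ₗ (TensorProduct.assoc k P Q R).toLinearMap)
    (q r : ℤ) (a : C →ₗ[k] P) (b : C →ₗ[k] Q) (c : C →ₗ[k] R) :
    cv m₁ r (cv m₂ q a b) c = cv m₃ (q + r) a (cv m₄ r b c) := by
  have hd : com k C ∈ homDeg k C (C ⊗[k] C) 0 := IsCCDGCoalgebra.comul_deg
  have e1 : tmap r (cv m₂ q a b) c =
      LinearMap.rTensor R m₂ ∘ₗ tmap r (tmap q a b) c ∘ₗ LinearMap.rTensor C (com k C) := by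
    rw [cv, LinearMap.rTensor, LinearMap.rTensor, tmap_comp_map r hd, map_comp_tmap]; rfl
  have e2 : tmap (q + r) a (cv m₄ r b c) =
      LinearMap.lTensor P m₄ ∘ₗ tmap (q + r) a (tmap r b c) ∘ₗ LinearMap.lTensor C (com k C) := by
    rw [cv, LinearMap.lTensor, LinearMap.lTensor, tmap_comp_map (q + r) id_deg, map_comp_tmap]
    rfl
  rw [cv, e1, cv, e2]
  simp only [LinearMap.comp_assoc]
  rw [← Coalgebra.coassoc]
  simp only [← LinearMap.comp_assoc]
  rw [h]
  simp only [LinearMap.comp_assoc]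
  congr 2
  simp only [← LinearMap.comp_assoc]
  rw [← assoc_tmap]

theorem cv_one_left [IsCCDGCoalgebra k C] {μ : P ⊗[k] Q →ₗ[k] Q} {e : k →ₗ[k] P}
    (h : μ ∘ₗ LinearMap.rTensor Q e = (TensorProduct.lid k Q).toLinearMap) (n : ℤ)
    (b : C →ₗ[k] Q) : cv μ n (e ∘ₗ cou k C) b = b := by
  have e1 : TensorProduct.map (e ∘ₗ cou k C) b =
      LinearMap.rTensor Q e ∘ₗ LinearMap.lTensor k b ∘ₗ LinearMap.rTensor C (cou k C) := by
    simp only [LinearMap.rTensor, LinearMap.lTensor, ← TensorProduct.map_comp,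
      LinearMap.id_comp, LinearMap.comp_id]
  rw [cv, tmap_cou, e1]
  simp only [LinearMap.comp_assoc]
  rw [Coalgebra.rTensor_counit_comp_comul, ← LinearMap.comp_assoc, h]
  ext x; simp

theorem cv_one_right {μ : Q ⊗[k] P →ₗ[k] Q} {e : k →ₗ[k] P}
    (h : μ ∘ₗ LinearMap.lTensor Q e = (TensorProduct.rid k Q).toLinearMap)
    (b : C →ₗ[k] Q) : cv μ 0 b (e ∘ₗ cou k C) = b := by
  have e1 : TensorProduct.map b (e ∘ₗ cou k C) =
      LinearMap.lTensor Q e ∘ₗ LinearMap.rTensor k b ∘ₗ LinearMap.lTensor C (cou k C) := by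
    simp only [LinearMap.rTensor, LinearMap.lTensor, ← TensorProduct.map_comp,
      LinearMap.id_comp, LinearMap.comp_id]
  rw [cv, tmap_zero_deg, e1]
  simp only [LinearMap.comp_assoc]
  rw [Coalgebra.lTensor_counit_comp_comul, ← LinearMap.comp_assoc, h]
  ext x; simp

theorem cv_zero_left (μ : P ⊗[k] Q →ₗ[k] R) (n : ℤ) (b : C →ₗ[k] Q) :
    cv μ n (0 : C →ₗ[k] P) b = 0 := by
  simp [cv, tmap]

variable {Ω M M' : Type u}
  [AddCommGroup Ω] [Module k Ω] [DGSpace k Ω]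
  [AddCommGroup M] [Module k M] [DGSpace k M]
  [AddCommGroup M'] [Module k M'] [DGSpace k M']

theorem cv_deg [IsCCDGCoalgebra k C] {μ : Ω ⊗[k] M →ₗ[k] M'} (hμ : μ ∈ homDeg k (Ω ⊗[k] M) M' 0)
    {p q r : ℤ} (n : ℤ) (h : p + q = r)
    {a : C →ₗ[k] Ω} (ha : a ∈ homDeg k C Ω p) {b : C →ₗ[k] M} (hb : b ∈ homDeg k C M q) :
    cv μ n a b ∈ homDeg k C M' r :=
  comp_deg (add_zero r) (comp_deg (by omega) IsCCDGCoalgebra.comul_deg (tmap_deg p q n ha hb)) hμ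

theorem homDif_cv_left [IsCCDGCoalgebra k C] {μ : Ω ⊗[k] M →ₗ[k] M'} (hμ : IsChain μ) (n : ℤ)
    {a : C →ₗ[k] Ω} (ha : a ∈ homDeg k C Ω n) {b : C →ₗ[k] M} (hb : IsChain b) :
    homDif n (cv μ 0 a b) = cv μ 0 (homDif n a) b := by
  rw [cv, homDif_comp n _ hμ IsCCDGCoalgebra.comul_chain, homDif_tmap_left n ha hb, cv]

theorem homDif_cv_right [IsCCDGCoalgebra k C] {μ : Ω ⊗[k] M →ₗ[k] M'} (hμ : IsChain μ) (n : ℤ)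
    {a : C →ₗ[k] Ω} (ha : a ∈ homDeg k C Ω 0) (hac : IsChain a) (b : C →ₗ[k] M) :
    homDif n (cv μ n a b) = cv μ (n - 1) a (homDif n b) := by
  rw [cv, homDif_comp n _ hμ IsCCDGCoalgebra.comul_chain, homDif_tmap_right n ha hac, cv]

theorem midSwap_comul [IsCCDGCoalgebra k C] :
    midSwap k C C C C ∘ₗ TensorProduct.map (com k C) (com k C) ∘ₗ com k C =
      TensorProduct.map (com k C) (com k C) ∘ₗ com k C := by
  have h : (TensorProduct.assoc k C C (C ⊗[k] C)).toLinearMap ∘ₗ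
      TensorProduct.map (com k C) (com k C) ∘ₗ com k C =
      LinearMap.lTensor C ((TensorProduct.assoc k C C C).toLinearMap ∘ₗ
        LinearMap.rTensor C (com k C) ∘ₗ com k C) ∘ₗ com k C := by
    have e1 : TensorProduct.map (com k C) (com k C) =
        LinearMap.lTensor (C ⊗[k] C) (com k C) ∘ₗ LinearMap.rTensor C (com k C) := by
      rw [LinearMap.lTensor_comp_rTensor]
    have e2 : (TensorProduct.assoc k C C (C ⊗[k] C)).toLinearMap ∘ₗ
        LinearMap.lTensor (C ⊗[k] C) (com k C) =
        LinearMap.lTensor C (LinearMap.lTensor C (com k C)) ∘ₗ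
          (TensorProduct.assoc k C C C).toLinearMap := by
      ext x y z; simp
    rw [e1, LinearMap.comp_assoc, ← LinearMap.comp_assoc, e2, LinearMap.comp_assoc,
      Coalgebra.coassoc, ← LinearMap.comp_assoc, ← LinearMap.lTensor_comp]
  rw [← LinearMap.cancel_left (f := (TensorProduct.assoc k C C (C ⊗[k] C)).toLinearMap)
    (TensorProduct.assoc k C C (C ⊗[k] C)).injective, h]
  have h2 : (TensorProduct.assoc k C C (C ⊗[k] C)).toLinearMap ∘ₗ midSwap k C C C C =
      LinearMap.lTensor C ((TensorProduct.assoc k C C C).toLinearMap ∘ₗ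
      (LinearMap.rTensor C (swap k C C)) ∘ₗ
      (TensorProduct.assoc k C C C).symm.toLinearMap) ∘ₗ
    (TensorProduct.assoc k C C (C ⊗[k] C)).toLinearMap := by
    rw [midSwap, ← LinearMap.comp_assoc]
    simp
  rw [← LinearMap.comp_assoc, h2, LinearMap.comp_assoc, h, ← LinearMap.comp_assoc,
    ← LinearMap.lTensor_comp]
  congr 2
  have h3 : (TensorProduct.assoc k C C C).symm.toLinearMap ∘ₗ
    (TensorProduct.assoc k C C C).toLinearMap = LinearMap.id := by simp
  simp only [LinearMap.comp_assoc]
  rw [← LinearMap.comp_assoc _ _ (TensorProduct.assoc k C C C).symm.toLinearMap, h3,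
    LinearMap.id_comp, ← LinearMap.comp_assoc _ _ (LinearMap.rTensor C (swap k C C)),
    ← LinearMap.rTensor_comp, IsCCDGCoalgebra.cocomm]

/-- The action of `Ω ⊗ Ω` on `M ⊗ M'`. -/
noncomputable def act₂ (γ : Ω ⊗[k] M →ₗ[k] M) (γ' : Ω ⊗[k] M' →ₗ[k] M') :
    (Ω ⊗[k] Ω) ⊗[k] (M ⊗[k] M') →ₗ[k] M ⊗[k] M' :=
  TensorProduct.map γ γ' ∘ₗ midSwap k Ω M Ω M'

theorem act₂_tmul (γ : Ω ⊗[k] M →ₗ[k] M) (γ' : Ω ⊗[k] M' →ₗ[k] M') {i j : ℤ} (a : Ω) {b : Ω}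
    (hb : b ∈ gr k Ω i) {x : M} (hx : x ∈ gr k M j) (y : M') :
    act₂ γ γ' ((a ⊗ₜ b) ⊗ₜ (x ⊗ₜ y)) = ((-1 : k) ^ (i * j)) • (γ (a ⊗ₜ x) ⊗ₜ γ' (b ⊗ₜ y)) := by
  rw [act₂, LinearMap.comp_apply, midSwap_tmul _ hb hx, map_smul, TensorProduct.map_tmul]

theorem act₂_assoc {μ : Ω ⊗[k] Ω →ₗ[k] Ω} {γ : Ω ⊗[k] M →ₗ[k] M} {γ' : Ω ⊗[k] M' →ₗ[k] M'}
    (hμ : μ ∈ homDeg k (Ω ⊗[k] Ω) Ω 0) (hγ : γ ∈ homDeg k (Ω ⊗[k] M) M 0)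
    (h : γ ∘ₗ LinearMap.rTensor M μ =
      γ ∘ₗ LinearMap.lTensor Ω γ ∘ₗ (TensorProduct.assoc k Ω Ω M).toLinearMap)
    (h' : γ' ∘ₗ LinearMap.rTensor M' μ =
      γ' ∘ₗ LinearMap.lTensor Ω γ' ∘ₗ (TensorProduct.assoc k Ω Ω M').toLinearMap) :
    act₂ γ γ' ∘ₗ LinearMap.rTensor (M ⊗[k] M') (act₂ μ μ) =
      act₂ γ γ' ∘ₗ LinearMap.lTensor (Ω ⊗[k] Ω) (act₂ γ γ') ∘ₗ
        (TensorProduct.assoc k (Ω ⊗[k] Ω) (Ω ⊗[k] Ω) (M ⊗[k] M')).toLinearMap := by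
  refine TensorProduct.ext (tensor4_ext fun i₀ i₁ i₂ i₃ x₀ h₀ x₁ h₁ x₂ h₂ x₃ h₃ =>
    tensor_ext_gr fun i₄ i₅ x₄ h₄ x₅ h₅ => ?_)
  have e := fun (a b : Ω) (x : M) => LinearMap.congr_fun h ((a ⊗ₜ b) ⊗ₜ x)
  have e' := fun (a b : Ω) (x : M') => LinearMap.congr_fun h' ((a ⊗ₜ b) ⊗ₜ x)
  simp only [LinearMap.comp_apply, LinearMap.rTensor_tmul, LinearMap.lTensor_tmul,
    LinearEquiv.coe_coe, TensorProduct.assoc_tmul] at e e'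
  change act₂ γ γ' (act₂ μ μ ((x₀ ⊗ₜ x₁) ⊗ₜ (x₂ ⊗ₜ x₃)) ⊗ₜ (x₄ ⊗ₜ x₅)) =
    act₂ γ γ' ((x₀ ⊗ₜ x₁) ⊗ₜ act₂ γ γ' ((x₂ ⊗ₜ x₃) ⊗ₜ (x₄ ⊗ₜ x₅)))
  have m1 : μ (x₁ ⊗ₜ x₃) ∈ gr k Ω (i₁ + i₃) := by
    have := hμ _ _ (tmul_mem rfl h₁ h₃); rwa [add_zero] at this
  have m2 : γ (x₂ ⊗ₜ x₄) ∈ gr k M (i₂ + i₄) := by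
    have := hγ _ _ (tmul_mem rfl h₂ h₄); rwa [add_zero] at this
  rw [act₂_tmul μ μ x₀ h₁ h₂ x₃, act₂_tmul γ γ' x₂ h₃ h₄ x₅, ← TensorProduct.smul_tmul',
    TensorProduct.tmul_smul, map_smul, map_smul, act₂_tmul γ γ' _ m1 h₄, act₂_tmul γ γ' _ h₁ m2,
    e, e', smul_smul, smul_smul, ← zpow_add₀ (by simp), ← zpow_add₀ (by simp)]
  congr 2; ring

theorem act₂_one {e : k →ₗ[k] Ω} {γ : Ω ⊗[k] M →ₗ[k] M} {γ' : Ω ⊗[k] M' →ₗ[k] M'}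
    (he : e ∈ homDeg k k Ω 0)
    (h : γ ∘ₗ LinearMap.rTensor M e = (TensorProduct.lid k M).toLinearMap)
    (h' : γ' ∘ₗ LinearMap.rTensor M' e = (TensorProduct.lid k M').toLinearMap) :
    act₂ γ γ' ∘ₗ LinearMap.rTensor (M ⊗[k] M')
      (TensorProduct.map e e ∘ₗ (TensorProduct.lid k k).symm.toLinearMap) =
      (TensorProduct.lid k (M ⊗[k] M')).toLinearMap := by
  refine TensorProduct.ext (LinearMap.ext_ring (tensor_ext_gr fun i j x hx y hy => ?_))
  have a1 := LinearMap.congr_fun h (1 ⊗ₜ x)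
  have a2 := LinearMap.congr_fun h' (1 ⊗ₜ y)
  have m1 : e 1 ∈ gr k Ω 0 := by simpa using he _ _ (mem_gr_field 1)
  simp only [LinearMap.comp_apply, LinearMap.rTensor_tmul, LinearEquiv.coe_coe,
    TensorProduct.lid_tmul, one_smul] at a1 a2
  change act₂ γ γ' ((TensorProduct.map e e ((TensorProduct.lid k k).symm 1)) ⊗ₜ (x ⊗ₜ y)) =
    TensorProduct.lid k _ (1 ⊗ₜ (x ⊗ₜ y))
  rw [TensorProduct.lid_symm_apply, TensorProduct.map_tmul, act₂_tmul γ γ' _ m1 hx, a1, a2]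
  simp

theorem act₂_mul_one {e : k →ₗ[k] Ω} {μ : Ω ⊗[k] Ω →ₗ[k] Ω} (he : e ∈ homDeg k k Ω 0)
    (h : μ ∘ₗ LinearMap.lTensor Ω e = (TensorProduct.rid k Ω).toLinearMap) :
    act₂ μ μ ∘ₗ LinearMap.lTensor (Ω ⊗[k] Ω)
      (TensorProduct.map e e ∘ₗ (TensorProduct.lid k k).symm.toLinearMap) =
      (TensorProduct.rid k (Ω ⊗[k] Ω)).toLinearMap := by
  refine TensorProduct.ext (tensor_ext_gr fun i j x hx y hy => LinearMap.ext_ring ?_)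
  have a1 := LinearMap.congr_fun h (x ⊗ₜ 1)
  have a2 := LinearMap.congr_fun h (y ⊗ₜ 1)
  have m1 : e 1 ∈ gr k Ω 0 := by simpa using he _ _ (mem_gr_field 1)
  simp only [LinearMap.comp_apply, LinearMap.lTensor_tmul, LinearEquiv.coe_coe,
    TensorProduct.rid_tmul, one_smul] at a1 a2
  change act₂ μ μ ((x ⊗ₜ y) ⊗ₜ (TensorProduct.map e e ((TensorProduct.lid k k).symm 1))) =
    TensorProduct.rid k _ ((x ⊗ₜ y) ⊗ₜ 1)
  rw [TensorProduct.lid_symm_apply, TensorProduct.map_tmul, act₂_tmul μ μ _ hy m1, a1, a2]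
  simp

theorem cv_act₂ [IsCCDGCoalgebra k C] (μ : Ω ⊗[k] Ω →ₗ[k] Ω) (p' q q' : ℤ) (a : C →ₗ[k] Ω)
    {a' : C →ₗ[k] Ω} (ha' : a' ∈ homDeg k C Ω p') {b : C →ₗ[k] Ω} (hb : b ∈ homDeg k C Ω q)
    (b' : C →ₗ[k] Ω) :
    cv (act₂ μ μ) (q + q') (tmap p' a a' ∘ₗ com k C) (tmap q' b b' ∘ₗ com k C) =
      ((-1 : k) ^ (p' * q)) • (tmap (p' + q') (cv μ q a b) (cv μ q' a' b') ∘ₗ com k C) := by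
  have hd : com k C ∈ homDeg k C (C ⊗[k] C) 0 := IsCCDGCoalgebra.comul_deg
  rw [cv, ← tmap_comp_map _ hd, act₂]
  simp only [← LinearMap.comp_assoc]
  rw [LinearMap.comp_assoc (tmap (q + q') _ _), midSwap_tmap p' q q' a b' ha' hb]
  simp only [LinearMap.comp_smul, LinearMap.smul_comp, LinearMap.comp_assoc]
  rw [midSwap_comul, ← LinearMap.comp_assoc (com k C), tmap_comp_map _ hd, ← LinearMap.comp_assoc,
    map_comp_tmap]
  rfl

end Conv

section Hom

variable {k : Type u} [Field k]
variable {C D E Ω : Type u}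
  [AddCommGroup C] [Module k C] [DGSpace k C] [Coalgebra k C]
  [AddCommGroup D] [Module k D] [DGSpace k D] [Coalgebra k D]
  [AddCommGroup E] [Module k E] [DGSpace k E] [Coalgebra k E]
  [AddCommGroup Ω] [Module k Ω] [DGSpace k Ω] [Coalgebra k Ω]

/-- Morphisms of ccdg-coalgebras. -/
structure IsCoalgHom (f : C →ₗ[k] D) : Prop where
  deg : f ∈ homDeg k C D 0
  chain : homDif 0 f = 0
  counit : cou k D ∘ₗ f = cou k C
  comul : com k D ∘ₗ f = tmap 0 f f ∘ₗ com k C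

theorem IsCoalgHom.isChain {f : C →ₗ[k] D} (h : IsCoalgHom f) : IsChain f :=
  (isChain_iff f).2 h.chain

theorem isCoalgHom_id : IsCoalgHom (LinearMap.id : C →ₗ[k] C) where
  deg := id_deg
  chain := (isChain_iff _).1 isChain_id
  counit := rfl
  comul := by simp [tmap_zero_deg]

theorem IsCoalgHom.comp {g : D →ₗ[k] E} {f : C →ₗ[k] D} (hg : IsCoalgHom g) (hf : IsCoalgHom f) :
    IsCoalgHom (g ∘ₗ f) where
  deg := comp_deg (add_zero 0) hf.deg hg.deg
  chain := (isChain_iff _).1 (hg.isChain.comp hf.isChain)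
  counit := by rw [← LinearMap.comp_assoc, hg.counit, hf.counit]
  comul := by
    rw [← LinearMap.comp_assoc, hg.comul, LinearMap.comp_assoc, hf.comul, ← LinearMap.comp_assoc,
      tmap_zero_deg, tmap_zero_deg, tmap_zero_deg, TensorProduct.map_comp]

/-- Homotopy pairs `(f(t), ξ(t))` of polynomials `f(t) = ∑ f i t ^ i` and `ξ(t) = ∑ ξ i t ^ i` with
coefficients linear maps of degree `0` and `1`: `d/dt f(t) = ∂ ξ(t)`, `f(0)` is a morphism of
ccdg-coalgebras, `ε ∘ ξ(t) = 0` and `Δ ∘ ξ(t) = (f(t) ⊗ ξ(t) + ξ(t) ⊗ f(t)) ∘ Δ`. All identities are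
written coefficientwise in `t`. -/
structure IsHtpyPair (f ξ : ℕ →₀ (C →ₗ[k] D)) : Prop where
  f_deg : ∀ i, f i ∈ homDeg k C D 0
  ξ_deg : ∀ i, ξ i ∈ homDeg k C D 1
  deriv : ∀ i : ℕ, ((i : k) + 1) • f (i + 1) = homDif 1 (ξ i)
  start : IsCoalgHom (f 0)
  counit : ∀ i, cou k D ∘ₗ ξ i = 0
  comul : ∀ i, com k D ∘ₗ ξ i = ∑ p ∈ Finset.HasAntidiagonal.antidiagonal i,
    (tmap 1 (f p.1) (ξ p.2) + tmap 0 (ξ p.1) (f p.2)) ∘ₗ com k C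

/-- `g` and `g'` are joined by a homotopy pair with `f(0) = g` and `f(1) = g'`. -/
def Homotopic (g g' : C →ₗ[k] D) : Prop :=
  ∃ f ξ : ℕ →₀ (C →ₗ[k] D), IsHtpyPair f ξ ∧ f 0 = g ∧ (f.sum fun _ a => a) = g'

theorem sum_mapRange {X Y : Type*} [AddCommGroup X] [AddCommGroup Y] [Module k X] [Module k Y]
    (L : X →ₗ[k] Y) (f : ℕ →₀ X) :
    ((Finsupp.mapRange.linearMap L f).sum fun _ a => a) = L (f.sum fun _ a => a) := by
  rw [Finsupp.mapRange.linearMap_apply, Finsupp.sum_mapRange_index (by simp), Finsupp.sum,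
    Finsupp.sum, map_sum]

theorem Homotopic.transport {C' D' : Type u}
    [AddCommGroup C'] [Module k C'] [DGSpace k C'] [Coalgebra k C']
    [AddCommGroup D'] [Module k D'] [DGSpace k D'] [Coalgebra k D']
    (L : (C →ₗ[k] D) →ₗ[k] (C' →ₗ[k] D'))
    (hdeg : ∀ n, ∀ a ∈ homDeg k C D n, L a ∈ homDeg k C' D' n)
    (hdif : ∀ a ∈ homDeg k C D 1, homDif 1 (L a) = L (homDif 1 a))
    (hhom : ∀ a, IsCoalgHom a → IsCoalgHom (L a))
    (hcou : ∀ a, cou k D ∘ₗ a = 0 → cou k D' ∘ₗ L a = 0)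
    (hcom : ∀ (i : ℕ) (f ξ : ℕ → (C →ₗ[k] D)), (∀ i, f i ∈ homDeg k C D 0) →
      (∀ i, ξ i ∈ homDeg k C D 1) →
      com k D ∘ₗ ξ i = ∑ p ∈ Finset.HasAntidiagonal.antidiagonal i,
        (tmap 1 (f p.1) (ξ p.2) + tmap 0 (ξ p.1) (f p.2)) ∘ₗ com k C →
      com k D' ∘ₗ L (ξ i) = ∑ p ∈ Finset.HasAntidiagonal.antidiagonal i,
        (tmap 1 (L (f p.1)) (L (ξ p.2)) + tmap 0 (L (ξ p.1)) (L (f p.2))) ∘ₗ com k C')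
    {g g' : C →ₗ[k] D} (h : Homotopic g g') : Homotopic (L g) (L g') := by
  obtain ⟨f, ξ, hp, rfl, rfl⟩ := h
  refine ⟨Finsupp.mapRange.linearMap L f, Finsupp.mapRange.linearMap L ξ, ⟨?_, ?_, ?_, ?_, ?_, ?_⟩,
    by simp, sum_mapRange L f⟩
  · intro i; simpa using hdeg _ _ (hp.f_deg i)
  · intro i; simpa using hdeg _ _ (hp.ξ_deg i)
  · intro i
    simp only [Finsupp.mapRange.linearMap_apply, Finsupp.mapRange_apply]
    rw [hdif _ (hp.ξ_deg i), ← hp.deriv i, map_smul]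
  · simpa using hhom _ hp.start
  · intro i; simpa using hcou _ (hp.counit i)
  · intro i
    simpa using hcom i f ξ hp.f_deg hp.ξ_deg (hp.comul i)

theorem Homotopic.comp_left {g g' : C →ₗ[k] D} (h : Homotopic g g') {l : D →ₗ[k] E}
    (hl : IsCoalgHom l) : Homotopic (l ∘ₗ g) (l ∘ₗ g') := by
  refine Homotopic.transport (LinearMap.llcomp k C D E l) ?_ ?_ ?_ ?_ ?_ h
  · intro n a ha; exact comp_deg (add_zero n) ha hl.deg
  · intro a _; exact homDif_comp_left 1 a hl.isChain
  · intro a ha; exact hl.comp ha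
  · intro a ha
    change cou k E ∘ₗ l ∘ₗ a = 0
    rw [← LinearMap.comp_assoc, hl.counit, ha]
  · intro i f ξ _ _ hi
    change com k E ∘ₗ l ∘ₗ ξ i = ∑ p ∈ Finset.HasAntidiagonal.antidiagonal i,
      (tmap 1 (l ∘ₗ f p.1) (l ∘ₗ ξ p.2) + tmap 0 (l ∘ₗ ξ p.1) (l ∘ₗ f p.2)) ∘ₗ com k C
    rw [← LinearMap.comp_assoc, hl.comul, LinearMap.comp_assoc, hi, tmap_zero_deg]
    ext x
    simp [← map_comp_tmap]

theorem Homotopic.comp_right {g g' : D →ₗ[k] E} (h : Homotopic g g') {l : C →ₗ[k] D}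
    (hl : IsCoalgHom l) : Homotopic (g ∘ₗ l) (g' ∘ₗ l) := by
  refine Homotopic.transport (LinearMap.lcomp k E l) ?_ ?_ ?_ ?_ ?_ h
  · intro n a ha; exact comp_deg (zero_add n) hl.deg ha
  · intro a _; exact homDif_comp_right 1 a hl.isChain
  · intro a ha; exact ha.comp hl
  · intro a ha
    change cou k E ∘ₗ a ∘ₗ l = 0
    rw [← LinearMap.comp_assoc, ha, LinearMap.zero_comp]
  · intro i f ξ _ _ hi
    change com k E ∘ₗ ξ i ∘ₗ l = ∑ p ∈ Finset.HasAntidiagonal.antidiagonal i,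
      (tmap 1 (f p.1 ∘ₗ l) (ξ p.2 ∘ₗ l) + tmap 0 (ξ p.1 ∘ₗ l) (f p.2 ∘ₗ l)) ∘ₗ com k C
    rw [← LinearMap.comp_assoc, hi]
    ext x
    simp only [LinearMap.comp_apply, LinearMap.sum_apply, LinearMap.add_apply,
      ← tmap_comp_map _ hl.deg]
    have := LinearMap.congr_fun hl.comul x
    simp only [LinearMap.comp_apply, tmap_zero_deg] at this
    simp [this]

variable [IsCCDGCoalgebra k C] [IsCCDGCoalgebra k Ω] [CCDGHopfStr k Ω]

variable (k Ω) in
/-- The multiplication. -/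
abbrev hmul : Ω ⊗[k] Ω →ₗ[k] Ω := CCDGHopfStr.mul

variable (k Ω) in
/-- The unit. -/
abbrev hone : k →ₗ[k] Ω := CCDGHopfStr.one

variable (k Ω) in
/-- The antipode. -/
abbrev hanti : Ω →ₗ[k] Ω := CCDGHopfStr.antipode

/-- The convolution product `m ∘ (a ⊗ b) ∘ Δ`, where `n` is the degree of `b`. -/
noncomputable abbrev convol (n : ℤ) (a b : C →ₗ[k] Ω) : C →ₗ[k] Ω := cv (hmul k Ω) n a b

variable (k C Ω) in
/-- The unit `u ∘ ε` of the convolution product. -/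
noncomputable abbrev convOne : C →ₗ[k] Ω := hone k Ω ∘ₗ cou k C

theorem conv_assoc (q r : ℤ) (a b c : C →ₗ[k] Ω) :
    convol r (convol q a b) c = convol (q + r) a (convol r b c) :=
  cv_assoc CCDGHopfStr.mul_assoc q r a b c

theorem convOne_conv (n : ℤ) (a : C →ₗ[k] Ω) : convol n (convOne k C Ω) a = a :=
  cv_one_left CCDGHopfStr.one_mul n a

theorem conv_convOne (a : C →ₗ[k] Ω) : convol 0 a (convOne k C Ω) = a :=
  cv_one_right CCDGHopfStr.mul_one a

theorem com_conv (n : ℤ) (a b : C →ₗ[k] Ω) :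
    com k Ω ∘ₗ convol n a b = cv (act₂ (hmul k Ω) (hmul k Ω)) n (com k Ω ∘ₗ a) (com k Ω ∘ₗ b) := by
  rw [convol, cv, cv, ← map_comp_tmap, ← LinearMap.comp_assoc, CCDGHopfStr.comul_mul, act₂]
  rfl

theorem cou_conv (n : ℤ) (a b : C →ₗ[k] Ω) :
    cou k Ω ∘ₗ convol n a b = cv (TensorProduct.lid k k).toLinearMap n (cou k Ω ∘ₗ a)
      (cou k Ω ∘ₗ b) := by
  rw [convol, cv, cv, ← map_comp_tmap, ← LinearMap.comp_assoc, CCDGHopfStr.counit_mul]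
  rfl

theorem lid_cv (n : ℤ) (b : C →ₗ[k] k) : cv (TensorProduct.lid k k).toLinearMap n (cou k C) b = b := by
  have h := cv_one_left (C := C) (μ := (TensorProduct.lid k k).toLinearMap) (e := LinearMap.id)
    (by rw [LinearMap.rTensor_id]; rfl) n b
  rwa [LinearMap.id_comp] at h

theorem lid_cv' (b : C →ₗ[k] k) : cv (TensorProduct.lid k k).toLinearMap 0 b (cou k C) = b := by
  have h := cv_one_right (C := C) (μ := (TensorProduct.lid k k).toLinearMap) (e := LinearMap.id)
    (by rw [LinearMap.lTensor_id]; ext; simp) b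
  rwa [LinearMap.id_comp] at h

theorem com_convOne : com k Ω ∘ₗ convOne k C Ω = (TensorProduct.map (hone k Ω) (hone k Ω) ∘ₗ
      (TensorProduct.lid k k).symm.toLinearMap) ∘ₗ cou k C := by
  rw [convOne, ← LinearMap.comp_assoc, CCDGHopfStr.comul_one]

theorem map_convOne : tmap 0 (convOne k C Ω) (convOne k C Ω) ∘ₗ com k C =
    (TensorProduct.map (hone k Ω) (hone k Ω) ∘ₗ
      (TensorProduct.lid k k).symm.toLinearMap) ∘ₗ cou k C := by
  have h := lid_cv (k := k) (C := C) 0 (cou k C)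
  rw [cv] at h
  rw [convOne, ← map_comp_tmap, LinearMap.comp_assoc, LinearMap.comp_assoc]
  congr 1
  conv_rhs => rw [← h]
  rw [← LinearMap.comp_assoc]
  simp

theorem isCoalgHom_convOne : IsCoalgHom (convOne k C Ω) where
  deg := comp_deg (add_zero 0) IsCCDGCoalgebra.counit_deg CCDGHopfStr.one_deg
  chain := (isChain_iff _).1 (CCDGHopfStr.one_chain.comp IsCCDGCoalgebra.counit_chain)
  counit := by rw [convOne, ← LinearMap.comp_assoc, CCDGHopfStr.counit_one, LinearMap.id_comp]
  comul := by rw [com_convOne, map_convOne]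

theorem IsCoalgHom.mul {g h : C →ₗ[k] Ω} (hg : IsCoalgHom g) (hh : IsCoalgHom h) :
    IsCoalgHom (convol 0 g h) where
  deg := cv_deg CCDGHopfStr.mul_deg 0 (add_zero 0) hg.deg hh.deg
  chain := by
    rw [homDif_cv_left CCDGHopfStr.mul_chain 0 hg.deg hh.isChain, hg.chain, cv_zero_left]
  counit := by rw [cou_conv, hg.counit, hh.counit, lid_cv]
  comul := by
    rw [com_conv, hg.comul, hh.comul]
    simpa using cv_act₂ (hmul k Ω) 0 0 0 g hg.deg hh.deg h

theorem hanti_conv {g : C →ₗ[k] Ω} (hg : IsCoalgHom g) :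
    convol 0 (hanti k Ω ∘ₗ g) g = convOne k C Ω := by
  have e : tmap 0 (hanti k Ω ∘ₗ g) g =
      TensorProduct.map (hanti k Ω) LinearMap.id ∘ₗ tmap 0 g g := by
    rw [map_comp_tmap, LinearMap.id_comp]
  rw [convol, cv, e, LinearMap.comp_assoc, ← hg.comul, convOne, ← hg.counit, ← LinearMap.comp_assoc,
    ← LinearMap.comp_assoc, LinearMap.comp_assoc (com k Ω), CCDGHopfStr.antipode_left]
  rfl

theorem conv_hanti {g : C →ₗ[k] Ω} (hg : IsCoalgHom g) :
    convol 0 g (hanti k Ω ∘ₗ g) = convOne k C Ω := by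
  have e : tmap 0 g (hanti k Ω ∘ₗ g) =
      TensorProduct.map LinearMap.id (hanti k Ω) ∘ₗ tmap 0 g g := by
    rw [map_comp_tmap, LinearMap.id_comp]
  rw [convol, cv, e, LinearMap.comp_assoc, ← hg.comul, convOne, ← hg.counit, ← LinearMap.comp_assoc,
    ← LinearMap.comp_assoc, LinearMap.comp_assoc (com k Ω), CCDGHopfStr.antipode_right]
  rfl

theorem IsCoalgHom.antipode {g : C →ₗ[k] Ω} (hg : IsCoalgHom g) : IsCoalgHom (hanti k Ω ∘ₗ g) := by
  have hdeg : hanti k Ω ∘ₗ g ∈ homDeg k C Ω 0 :=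
    comp_deg (add_zero 0) hg.deg CCDGHopfStr.antipode_deg
  refine ⟨hdeg, ?_, ?_, ?_⟩
  · have h1 : convol 0 (homDif 0 (hanti k Ω ∘ₗ g)) g = 0 := by
      have h0 := homDif_cv_left CCDGHopfStr.mul_chain 0 hdeg hg.isChain
      have h1 := hanti_conv hg
      rw [convol] at h1 ⊢
      rw [← h0, h1]
      exact isCoalgHom_convOne.chain
    have h2 := conv_assoc 0 0 (homDif 0 (hanti k Ω ∘ₗ g)) g (hanti k Ω ∘ₗ g)
    rwa [h1, convol, cv_zero_left, conv_hanti hg, add_zero, conv_convOne, eq_comm] at h2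
  · have h1 := cou_conv 0 g (hanti k Ω ∘ₗ g)
    rw [conv_hanti hg, hg.counit, lid_cv, isCoalgHom_convOne.counit] at h1
    exact h1.symm
  · have a1 := com_conv 0 g (hanti k Ω ∘ₗ g)
    rw [conv_hanti hg, com_convOne] at a1
    have a2 := cv_act₂ (hmul k Ω) 0 0 0 (hanti k Ω ∘ₗ g) hdeg hg.deg g
    rw [← hg.comul] at a2
    simp only [add_zero, mul_zero, zpow_zero, one_smul] at a2
    change _ = tmap 0 (convol 0 _ _) (convol 0 _ _) ∘ₗ _ at a2
    rw [hanti_conv hg, map_convOne] at a2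
    have a3 := cv_assoc (act₂_assoc (CCDGHopfStr.mul_deg (k := k) (Ω := Ω)) CCDGHopfStr.mul_deg
      CCDGHopfStr.mul_assoc CCDGHopfStr.mul_assoc) 0 0
      (tmap 0 (hanti k Ω ∘ₗ g) (hanti k Ω ∘ₗ g) ∘ₗ com k C)
      (com k Ω ∘ₗ g) (com k Ω ∘ₗ hanti k Ω ∘ₗ g)
    rw [a2, ← a1, cv_one_left (act₂_one CCDGHopfStr.one_deg CCDGHopfStr.one_mul
      CCDGHopfStr.one_mul), add_zero, cv_one_right (act₂_mul_one CCDGHopfStr.one_deg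
      CCDGHopfStr.mul_one)] at a3
    exact a3

theorem cv_add_left {P Q R : Type u} [AddCommGroup P] [Module k P] [AddCommGroup Q] [Module k Q]
    [AddCommGroup R] [Module k R] (μ : P ⊗[k] Q →ₗ[k] R) (n : ℤ) (a a' : C →ₗ[k] P)
    (b : C →ₗ[k] Q) : cv μ n (a + a') b = cv μ n a b + cv μ n a' b := by
  ext x; simp [cv, tmap, LinearMap.add_comp, TensorProduct.map_add_left]

theorem cv_add_right {P Q R : Type u} [AddCommGroup P] [Module k P] [AddCommGroup Q] [Module k Q]
    [AddCommGroup R] [Module k R] (μ : P ⊗[k] Q →ₗ[k] R) (n : ℤ) (a : C →ₗ[k] P)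
    (b b' : C →ₗ[k] Q) : cv μ n a (b + b') = cv μ n a b + cv μ n a b' := by
  ext x; simp [cv, tmap, TensorProduct.map_add_right]

/-- `b ↦ μ ∘ (a ⊗ b) ∘ Δ` as a linear map. -/
noncomputable def cvL {P Q R : Type u} [AddCommGroup P] [Module k P] [AddCommGroup Q] [Module k Q]
    [AddCommGroup R] [Module k R] (μ : P ⊗[k] Q →ₗ[k] R) (n : ℤ) (a : C →ₗ[k] P) :
    (C →ₗ[k] Q) →ₗ[k] (C →ₗ[k] R) where
  toFun b := cv μ n a b
  map_add' := cv_add_right μ n a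
  map_smul' c b := by ext x; simp [cv, tmap, TensorProduct.map_smul_right]

/-- `a ↦ μ ∘ (a ⊗ b) ∘ Δ` as a linear map. -/
noncomputable def cvR {P Q R : Type u} [AddCommGroup P] [Module k P] [AddCommGroup Q] [Module k Q]
    [AddCommGroup R] [Module k R] (μ : P ⊗[k] Q →ₗ[k] R) (n : ℤ) (b : C →ₗ[k] Q) :
    (C →ₗ[k] P) →ₗ[k] (C →ₗ[k] R) where
  toFun a := cv μ n a b
  map_add' a a' := cv_add_left μ n a a' b
  map_smul' c a := by ext x; simp [cv, tmap, LinearMap.smul_comp, TensorProduct.map_smul_left]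

theorem Homotopic.mul_left {h h' : C →ₗ[k] Ω} (H : Homotopic h h') {g : C →ₗ[k] Ω}
    (hg : IsCoalgHom g) : Homotopic (convol 0 g h) (convol 0 g h') := by
  obtain ⟨f, ξ, hp, rfl, rfl⟩ := H
  refine ⟨Finsupp.mapRange.linearMap (cvL (hmul k Ω) 0 g) f,
    Finsupp.mapRange.linearMap (cvL (hmul k Ω) 1 g) ξ, ⟨?_, ?_, ?_, ?_, ?_, ?_⟩,
    by simp [cvL], sum_mapRange _ f⟩
  · intro i
    simpa [cvL] using cv_deg CCDGHopfStr.mul_deg 0 (add_zero 0) hg.deg (hp.f_deg i)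
  · intro i
    simpa [cvL] using cv_deg CCDGHopfStr.mul_deg 1 (zero_add 1) hg.deg (hp.ξ_deg i)
  · intro i
    have e := homDif_cv_right (CCDGHopfStr.mul_chain (k := k) (Ω := Ω)) 1 hg.deg hg.isChain (ξ i)
    simp only [Finsupp.mapRange.linearMap_apply, Finsupp.mapRange_apply]
    rw [← map_smul, hp.deriv i]
    exact e.symm
  · simpa [cvL] using hg.mul hp.start
  · intro i
    simp only [Finsupp.mapRange.linearMap_apply, Finsupp.mapRange_apply]
    change cou k Ω ∘ₗ convol 1 g (ξ i) = 0
    rw [cou_conv, hp.counit i, hg.counit]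
    ext x; simp [cv, tmap]
  · intro i
    simp only [Finsupp.mapRange.linearMap_apply, Finsupp.mapRange_apply]
    change com k Ω ∘ₗ convol 1 g (ξ i) = ∑ p ∈ Finset.HasAntidiagonal.antidiagonal i,
      (tmap 1 (convol 0 g (f p.1)) (convol 1 g (ξ p.2)) +
        tmap 0 (convol 1 g (ξ p.1)) (convol 0 g (f p.2))) ∘ₗ com k C
    rw [com_conv, hp.comul i, hg.comul]
    change cvL _ 1 _ _ = _
    rw [map_sum]
    refine Finset.sum_congr rfl fun p _ => ?_
    rw [LinearMap.add_comp, LinearMap.add_comp, map_add]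
    have e1 := cv_act₂ (hmul k Ω) 0 0 1 g hg.deg (hp.f_deg p.1) (ξ p.2)
    have e2 := cv_act₂ (hmul k Ω) 0 1 0 g hg.deg (hp.ξ_deg p.1) (f p.2)
    simp only [zero_mul, zpow_zero, one_smul, zero_add, add_zero] at e1 e2
    exact congrArg₂ (· + ·) e1 e2

theorem Homotopic.mul_right {h h' : C →ₗ[k] Ω} (H : Homotopic h h') {g : C →ₗ[k] Ω}
    (hg : IsCoalgHom g) : Homotopic (convol 0 h g) (convol 0 h' g) := by
  refine Homotopic.transport (cvR (hmul k Ω) 0 g) ?_ ?_ ?_ ?_ ?_ H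
  · intro n a ha; exact cv_deg CCDGHopfStr.mul_deg 0 (add_zero n) ha hg.deg
  · intro a ha; exact homDif_cv_left CCDGHopfStr.mul_chain 1 ha hg.isChain
  · intro a ha; exact ha.mul hg
  · intro a ha
    change cou k Ω ∘ₗ convol 0 a g = 0
    rw [cou_conv, ha, cv_zero_left]
  · intro i f ξ hf hξ hi
    change com k Ω ∘ₗ convol 0 (ξ i) g = ∑ p ∈ Finset.HasAntidiagonal.antidiagonal i,
      (tmap 1 (convol 0 (f p.1) g) (convol 0 (ξ p.2) g) +
        tmap 0 (convol 0 (ξ p.1) g) (convol 0 (f p.2) g)) ∘ₗ com k C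
    rw [com_conv, hi, hg.comul]
    change cvR _ 0 _ _ = _
    rw [map_sum]
    refine Finset.sum_congr rfl fun p _ => ?_
    rw [LinearMap.add_comp, LinearMap.add_comp, map_add]
    have e1 := cv_act₂ (hmul k Ω) 1 0 0 (f p.1) (hξ p.2) hg.deg g
    have e2 := cv_act₂ (hmul k Ω) 0 0 0 (ξ p.1) (hf p.2) hg.deg g
    simp only [zero_mul, mul_zero, zpow_zero, one_smul, zero_add, add_zero] at e1 e2
    exact congrArg₂ (· + ·) e1 e2

end Hom

section Cat

/-- A ccdg-coalgebra over `k`. -/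
structure CCDGCoalg (k : Type u) [Field k] where
  carrier : Type u
  [addCommGroup : AddCommGroup carrier]
  [module : Module k carrier]
  [dgSpace : DGSpace k carrier]
  [coalgebra : Coalgebra k carrier]
  [isCCDGCoalgebra : IsCCDGCoalgebra k carrier]

attribute [instance] CCDGCoalg.addCommGroup CCDGCoalg.module CCDGCoalg.dgSpace
  CCDGCoalg.coalgebra CCDGCoalg.isCCDGCoalgebra

/-- A ccdg-Hopf algebra over `k`. -/
structure CCDGHopf (k : Type u) [Field k] extends CCDGCoalg k where
  [hopf : CCDGHopfStr k carrier]

attribute [instance] CCDGHopf.hopf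

variable {k : Type u} [Field k]

/-- The category of ccdg-coalgebras. -/
instance instCategoryCCDGCoalg : Category (CCDGCoalg k) where
  Hom C D := {f : C.carrier →ₗ[k] D.carrier // IsCoalgHom f}
  id C := ⟨LinearMap.id, isCoalgHom_id⟩
  comp f g := ⟨g.1 ∘ₗ f.1, g.2.comp f.2⟩

variable (k) in
/-- The homotopy relation on morphisms of ccdg-coalgebras. -/
def homotopyRel : HomRel (CCDGCoalg k) := fun _ _ f g => Homotopic f.1 g.1

variable (k) in
/-- The homotopy category of ccdg-coalgebras: its morphisms are the classes of morphisms for the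
equivalence relation generated by homotopy. -/
abbrev HoCC := CategoryTheory.Quotient (homotopyRel k)

variable (k) in
/-- The projection to the homotopy category. -/
abbrev ho : CCDGCoalg k ⥤ HoCC k := CategoryTheory.Quotient.functor (homotopyRel k)

end Cat

section HopfPresheaf

/-- The quotient of a group by the equivalence relation generated by a relation that is stable
under left and right multiplication. -/
abbrev quotGroup {G : Type*} [Group G] (r : G → G → Prop)
    (hl : ∀ a b c, r b c → r (a * b) (a * c)) (hr : ∀ a b c, r a b → r (a * c) (b * c)) :
    Group (Quot r) where
  mul := Quot.map₂ (· * ·) hl hr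
  one := Quot.mk r 1
  inv := Quot.lift (fun a => Quot.mk r a⁻¹) fun a b h => by
    have := hr _ _ b⁻¹ (hl a⁻¹ _ _ h)
    rw [inv_mul_cancel, one_mul, mul_assoc, mul_inv_cancel, mul_one] at this
    exact (Quot.sound this).symm
  mul_assoc := by
    rintro ⟨a⟩ ⟨b⟩ ⟨c⟩; exact congrArg (Quot.mk r) (mul_assoc a b c)
  one_mul := by rintro ⟨a⟩; exact congrArg (Quot.mk r) (one_mul a)
  mul_one := by rintro ⟨a⟩; exact congrArg (Quot.mk r) (mul_one a)
  inv_mul_cancel := by rintro ⟨a⟩; exact congrArg (Quot.mk r) (inv_mul_cancel a)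

variable {k : Type u} [Field k]

instance homotopyRel_precomp : HomRel.IsStableUnderPrecomp (homotopyRel k) where
  comp_left f _ _ h := Homotopic.comp_right h f.2

instance homotopyRel_postcomp : HomRel.IsStableUnderPostcomp (homotopyRel k) where
  comp_right g h := Homotopic.comp_left h g.2

/-- The convolution group of morphisms `C ⟶ Ω`: product `m ∘ (g ⊗ h) ∘ Δ`, unit `u ∘ ε`, inverse
`ς ∘ g`. -/
noncomputable instance homGroup (C : CCDGCoalg k) (Ω : CCDGHopf k) :
    Group (C ⟶ Ω.toCCDGCoalg) where
  mul g h := ⟨convol 0 g.1 h.1, g.2.mul h.2⟩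
  one := ⟨convOne k C.carrier Ω.carrier, isCoalgHom_convOne⟩
  inv g := ⟨hanti k Ω.carrier ∘ₗ g.1, g.2.antipode⟩
  mul_assoc a b c := Subtype.ext (conv_assoc 0 0 a.1 b.1 c.1)
  one_mul a := Subtype.ext (convOne_conv 0 a.1)
  mul_one a := Subtype.ext (conv_convOne a.1)
  inv_mul_cancel a := Subtype.ext (hanti_conv a.2)

theorem comp_mul {B C : CCDGCoalg k} {Ω : CCDGHopf k} (f : B ⟶ C) (g h : C ⟶ Ω.toCCDGCoalg) :
    f ≫ (g * h) = (f ≫ g) * (f ≫ h) := by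
  refine Subtype.ext ?_
  change convol 0 g.1 h.1 ∘ₗ f.1 = convol 0 (g.1 ∘ₗ f.1) (h.1 ∘ₗ f.1)
  have e := tmap_comp_map 0 f.2.deg f.1 g.1 h.1
  rw [convol, convol, cv, LinearMap.comp_assoc, LinearMap.comp_assoc, f.2.comul, cv, ← e, tmap_zero_deg,
    tmap_zero_deg, LinearMap.comp_assoc]

/-- The group of homotopy types of morphisms to `Ω`, induced by convolution. -/
noncomputable instance hoGroup (X : HoCC k) (Ω : CCDGHopf k) :
    Group (X ⟶ (ho k).obj Ω.toCCDGCoalg) :=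
  quotGroup (G := X.as ⟶ Ω.toCCDGCoalg) (@HomRel.CompClosure _ _ (homotopyRel k) _ _)
    (fun a b c h => HomRel.CompClosure.of
      (r := homotopyRel k) (m₁ := a * b) (m₂ := a * c)
      (Homotopic.mul_left ((HomRel.compClosure_iff_self _ _ _).1 h) a.2))
    (fun a b c h => HomRel.CompClosure.of
      (r := homotopyRel k) (m₁ := a * c) (m₂ := b * c)
      (Homotopic.mul_right ((HomRel.compClosure_iff_self _ _ _).1 h) c.2))

/-- The presheaf of groups `C ↦ Hom_{ho ccdgC}(C, Ω)`, with restriction given by precomposition. -/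
noncomputable def hopfPresheaf (Ω : CCDGHopf k) : (HoCC k)ᵒᵖ ⥤ GrpCat.{u} where
  obj X := GrpCat.of (X.unop ⟶ (ho k).obj Ω.toCCDGCoalg)
  map {X Y} f := GrpCat.ofHom
    { toFun := fun g => f.unop ≫ g
      map_one' := by
        obtain ⟨f⟩ := f
        induction f using Quot.ind with
        | mk f =>
          refine congrArg (Quot.mk _) (Subtype.ext ?_)
          change (hone k Ω.carrier ∘ₗ cou k _) ∘ₗ f.1 = _
          rw [LinearMap.comp_assoc, f.2.counit]
          rfl
      map_mul' := by
        obtain ⟨f⟩ := f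
        induction f using Quot.ind with
        | mk f =>
          rintro ⟨g⟩ ⟨h⟩
          exact congrArg (Quot.mk _) (comp_mul f g h) }
  map_id X := by
    ext g
    exact Category.id_comp g
  map_comp f g := by
    ext h
    exact Category.assoc g.unop f.unop h

end HopfPresheaf

section Mod

/-- A left dg-module over `Ω`: a chain complex with a unital associative action that is a chain map
of degree `0`. -/
structure DGMod (k Ω : Type u) [Field k] [AddCommGroup Ω] [Module k Ω] [DGSpace k Ω]
    [Coalgebra k Ω] [CCDGHopfStr k Ω] where
  carrier : Type u
  [addCommGroup : AddCommGroup carrier]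
  [module : Module k carrier]
  [dgSpace : DGSpace k carrier]
  act : Ω ⊗[k] carrier →ₗ[k] carrier
  act_deg : act ∈ homDeg k (Ω ⊗[k] carrier) carrier 0
  act_chain : IsChain act
  act_one : act ∘ₗ LinearMap.rTensor carrier (hone k Ω) = (TensorProduct.lid k carrier).toLinearMap
  act_mul : act ∘ₗ LinearMap.rTensor carrier (hmul k Ω) =
    act ∘ₗ LinearMap.lTensor Ω act ∘ₗ (TensorProduct.assoc k Ω Ω carrier).toLinearMap

attribute [instance] DGMod.addCommGroup DGMod.module DGMod.dgSpace

variable {k Ω : Type u} [Field k] [AddCommGroup Ω] [Module k Ω] [DGSpace k Ω] [Coalgebra k Ω]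
  [IsCCDGCoalgebra k Ω] [CCDGHopfStr k Ω]

/-- Morphisms of dg-modules of degree `n` (not necessarily cycles): `ψ ∘ γ = γ' ∘ (1 ⊗ ψ)`. -/
def IsModHom (M M' : DGMod k Ω) (n : ℤ) (ψ : M.carrier →ₗ[k] M'.carrier) : Prop :=
  ψ ∈ homDeg k M.carrier M'.carrier n ∧ ψ ∘ₗ M.act = M'.act ∘ₗ tmap n LinearMap.id ψ

theorem act₂_deg {M M' : Type u} [AddCommGroup M] [Module k M] [DGSpace k M]
    [AddCommGroup M'] [Module k M'] [DGSpace k M'] {γ : Ω ⊗[k] M →ₗ[k] M}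
    {γ' : Ω ⊗[k] M' →ₗ[k] M'} (h : γ ∈ homDeg k (Ω ⊗[k] M) M 0)
    (h' : γ' ∈ homDeg k (Ω ⊗[k] M') M' 0) :
    act₂ γ γ' ∈ homDeg k ((Ω ⊗[k] Ω) ⊗[k] (M ⊗[k] M')) (M ⊗[k] M') 0 :=
  comp_deg (add_zero 0) midSwap_deg (map_deg h h')

theorem act₂_chain {M M' : Type u} [AddCommGroup M] [Module k M] [DGSpace k M]
    [AddCommGroup M'] [Module k M'] [DGSpace k M'] {γ : Ω ⊗[k] M →ₗ[k] M}
    {γ' : Ω ⊗[k] M' →ₗ[k] M'} (h : γ ∈ homDeg k (Ω ⊗[k] M) M 0) (hc : IsChain γ)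
    (hc' : IsChain γ') : IsChain (act₂ γ γ') :=
  (IsChain.map h hc hc').comp isChain_midSwap

/-- The tensor product of dg-modules, with action `(γ ⊗ γ') ∘ (1 ⊗ τ ⊗ 1) ∘ (Δ ⊗ 1)`. -/
noncomputable abbrev DGMod.tensor (M M' : DGMod k Ω) : DGMod k Ω where
  carrier := M.carrier ⊗[k] M'.carrier
  act := act₂ M.act M'.act ∘ₗ LinearMap.rTensor (M.carrier ⊗[k] M'.carrier) (com k Ω)
  act_deg := comp_deg (add_zero 0) (map_deg IsCCDGCoalgebra.comul_deg id_deg)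
    (act₂_deg M.act_deg M'.act_deg)
  act_chain := (act₂_chain M.act_deg M.act_chain M'.act_chain).comp
    (IsChain.map IsCCDGCoalgebra.comul_deg IsCCDGCoalgebra.comul_chain isChain_id)
  act_one := by
    rw [LinearMap.comp_assoc, ← LinearMap.rTensor_comp, CCDGHopfStr.comul_one,
      act₂_one CCDGHopfStr.one_deg M.act_one M'.act_one]
  act_mul := by
    have e : com k Ω ∘ₗ hmul k Ω = act₂ (hmul k Ω) (hmul k Ω) ∘ₗ
      TensorProduct.map (com k Ω) (com k Ω) := by rw [CCDGHopfStr.comul_mul]; rfl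
    rw [LinearMap.comp_assoc, ← LinearMap.rTensor_comp, e, LinearMap.rTensor_comp,
      ← LinearMap.comp_assoc, act₂_assoc CCDGHopfStr.mul_deg M.act_deg M.act_mul M'.act_mul,
      LinearMap.lTensor_comp]
    simp only [LinearMap.comp_assoc]
    congr 1
    refine TensorProduct.ext (TensorProduct.ext (LinearMap.ext fun a => LinearMap.ext fun b =>
      LinearMap.ext fun z => ?_))
    rfl

theorem lid_deg {V : Type u} [AddCommGroup V] [Module k V] [DGSpace k V] :
    (TensorProduct.lid k V).toLinearMap ∈ homDeg k (k ⊗[k] V) V 0 := by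
  refine fun n => tgr_le _ fun i j hij a ha x hx => ?_
  by_cases h : i = 0
  · subst h
    rw [add_zero, ← hij, zero_add]
    exact Submodule.smul_mem _ _ hx
  · rw [gr_field_ne h ha]; simp

theorem lid_chain {V : Type u} [AddCommGroup V] [Module k V] [DGSpace k V] :
    IsChain (TensorProduct.lid k V).toLinearMap := by
  refine TensorProduct.ext (LinearMap.ext_ring (LinearMap.ext fun x => ?_))
  change dif k V (TensorProduct.lid k V (1 ⊗ₜ x)) =
    TensorProduct.lid k V (dif k (k ⊗[k] V) (1 ⊗ₜ x))
  rw [dif_tensor, tdif_tmul (mem_gr_field 1), dif_field]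
  simp

variable (k Ω) in
/-- The unit object: the ground field, with action through the counit. -/
noncomputable abbrev DGMod.triv : DGMod k Ω where
  carrier := k
  act := (TensorProduct.lid k k).toLinearMap ∘ₗ LinearMap.rTensor k (cou k Ω)
  act_deg := comp_deg (add_zero 0) (map_deg IsCCDGCoalgebra.counit_deg id_deg) lid_deg
  act_chain := lid_chain.comp
    (IsChain.map IsCCDGCoalgebra.counit_deg IsCCDGCoalgebra.counit_chain isChain_id)
  act_one := by
    rw [LinearMap.comp_assoc, ← LinearMap.rTensor_comp, CCDGHopfStr.counit_one]
    simp
  act_mul := by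
    rw [LinearMap.comp_assoc, ← LinearMap.rTensor_comp, CCDGHopfStr.counit_mul]
    ext a b
    simp

variable (k Ω) in
/-- `Ω` as a left dg-module over itself. -/
noncomputable abbrev DGMod.self : DGMod k Ω where
  carrier := Ω
  act := hmul k Ω
  act_deg := CCDGHopfStr.mul_deg
  act_chain := CCDGHopfStr.mul_chain
  act_one := CCDGHopfStr.one_mul
  act_mul := CCDGHopfStr.mul_assoc

end Mod

section Maps

variable {k : Type u} [Field k] {C : Type u} [AddCommGroup C] [Module k C] [DGSpace k C]
  [Coalgebra k C]
variable {M N L : Type u}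
  [AddCommGroup M] [Module k M] [DGSpace k M]
  [AddCommGroup N] [Module k N] [DGSpace k N]
  [AddCommGroup L] [Module k L] [DGSpace k L]

variable (k C M) in
/-- The coaction of the cofree left `C`-comodule `C ⊗ M`. -/
noncomputable def coact : C ⊗[k] M →ₗ[k] C ⊗[k] (C ⊗[k] M) :=
  (TensorProduct.assoc k C C M).toLinearMap ∘ₗ LinearMap.rTensor M (com k C)

/-- `(1 ⊗ α) ∘ (Δ ⊗ 1)` for `α` of degree `n`. -/
noncomputable def pMap (n : ℤ) (α : C ⊗[k] M →ₗ[k] N) : C ⊗[k] M →ₗ[k] C ⊗[k] N :=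
  tmap n LinearMap.id α ∘ₗ coact k C M

variable (k C M) in
/-- The map `ε ⊗ 1 : C ⊗ M → M`. -/
noncomputable def couL : C ⊗[k] M →ₗ[k] M :=
  (TensorProduct.lid k M).toLinearMap ∘ₗ LinearMap.rTensor M (cou k C)

/-- `(ε ⊗ 1) ∘ φ`. -/
noncomputable def qMap (φ : C ⊗[k] M →ₗ[k] C ⊗[k] N) : C ⊗[k] M →ₗ[k] N :=
  couL k C N ∘ₗ φ

variable [IsCCDGCoalgebra k C]

theorem coact_deg : coact k C M ∈ homDeg k (C ⊗[k] M) (C ⊗[k] (C ⊗[k] M)) 0 :=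
  comp_deg (add_zero 0) (map_deg IsCCDGCoalgebra.comul_deg id_deg) assoc_deg

theorem coact_chain : IsChain (coact k C M) :=
  isChain_assoc.comp
    (IsChain.map IsCCDGCoalgebra.comul_deg IsCCDGCoalgebra.comul_chain isChain_id)

theorem couL_deg : couL k C M ∈ homDeg k (C ⊗[k] M) M 0 :=
  comp_deg (add_zero 0) (map_deg IsCCDGCoalgebra.counit_deg id_deg) lid_deg

theorem couL_chain : IsChain (couL k C M) :=
  lid_chain.comp (IsChain.map IsCCDGCoalgebra.counit_deg IsCCDGCoalgebra.counit_chain isChain_id)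

theorem pMap_deg {n : ℤ} {α : C ⊗[k] M →ₗ[k] N} (h : α ∈ homDeg k (C ⊗[k] M) N n) :
    pMap n α ∈ homDeg k (C ⊗[k] M) (C ⊗[k] N) n :=
  comp_deg (zero_add n) coact_deg (by simpa using tmap_deg 0 n n id_deg h)

theorem qMap_deg {n : ℤ} {φ : C ⊗[k] M →ₗ[k] C ⊗[k] N}
    (h : φ ∈ homDeg k (C ⊗[k] M) (C ⊗[k] N) n) : qMap φ ∈ homDeg k (C ⊗[k] M) N n :=
  comp_deg (add_zero n) h couL_deg

theorem homDif_pMap (n : ℤ) (α : C ⊗[k] M →ₗ[k] N) :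
    homDif n (pMap n α) = pMap (n - 1) (homDif n α) := by
  rw [pMap, homDif_comp_right n _ coact_chain, homDif_tmap_right n id_deg isChain_id, pMap]

theorem coact_tmap (n : ℤ) (ψ : M →ₗ[k] N) :
    coact k C N ∘ₗ tmap n LinearMap.id ψ = tmap n LinearMap.id (tmap n LinearMap.id ψ) ∘ₗ
      coact k C M := by
  have e1 : LinearMap.rTensor N (com k C) ∘ₗ tmap n LinearMap.id ψ =
      tmap n (tmap 0 LinearMap.id LinearMap.id) ψ ∘ₗ LinearMap.rTensor M (com k C) := by
    rw [LinearMap.rTensor, map_comp_tmap, LinearMap.rTensor,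
      tmap_comp_map n IsCCDGCoalgebra.comul_deg, tmap_zero_deg, TensorProduct.map_id]
    rfl
  rw [coact, LinearMap.comp_assoc, e1, ← LinearMap.comp_assoc, assoc_tmap, zero_add,
    LinearMap.comp_assoc]
  rfl

theorem coact_coact : coact k C (C ⊗[k] M) ∘ₗ coact k C M =
    LinearMap.lTensor C (coact k C M) ∘ₗ coact k C M := by
  refine TensorProduct.ext' fun c m => ?_
  have h := LinearMap.congr_fun (Coalgebra.coassoc (R := k) (A := C)) c
  let Λ := LinearMap.lTensor C (LinearMap.lTensor C ((TensorProduct.mk k C M).flip m))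
  have h1 : ∀ w, coact k C (C ⊗[k] M) (TensorProduct.assoc k C C M (w ⊗ₜ m)) =
      Λ (TensorProduct.assoc k C C C (LinearMap.rTensor C (com k C) w)) := by
    intro w
    induction w with
    | zero => simp
    | add x y hx hy => simp only [TensorProduct.add_tmul, map_add, hx, hy]
    | tmul x y =>
      simp only [TensorProduct.assoc_tmul, coact, LinearMap.comp_apply, LinearMap.rTensor_tmul,
        LinearEquiv.coe_coe]
      generalize com k C x = v
      induction v with
      | zero => simp
      | add x y hx hy => simp only [TensorProduct.add_tmul, map_add, hx, hy]
      | tmul x y => simp [Λ]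
  have h2 : ∀ w, LinearMap.lTensor C (coact k C M) (TensorProduct.assoc k C C M (w ⊗ₜ m)) =
      Λ (LinearMap.lTensor C (com k C) w) := by
    intro w
    induction w with
    | zero => simp
    | add x y hx hy => simp only [TensorProduct.add_tmul, map_add, hx, hy]
    | tmul x y =>
      simp only [TensorProduct.assoc_tmul, coact, LinearMap.comp_apply, LinearMap.lTensor_tmul,
        LinearEquiv.coe_coe, LinearMap.rTensor_tmul]
      generalize com k C y = v
      induction v with
      | zero => simp
      | add x y hx hy => simp only [TensorProduct.add_tmul, TensorProduct.tmul_add, map_add, hx, hy]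
      | tmul x y => simp [Λ]
  exact (h1 _).trans ((congrArg Λ h).trans (h2 _).symm)

theorem couL_coact : couL k C (C ⊗[k] M) ∘ₗ coact k C M = LinearMap.id := by
  refine TensorProduct.ext' fun c m => ?_
  have h := LinearMap.congr_fun (Coalgebra.rTensor_counit_comp_comul (R := k) (A := C)) c
  have h1 : ∀ w, couL k C (C ⊗[k] M) (TensorProduct.assoc k C C M (w ⊗ₜ m)) =
      (TensorProduct.lid k C (LinearMap.rTensor C (cou k C) w)) ⊗ₜ m := by
    intro w
    induction w with
    | zero => simp
    | add x y hx hy => simp only [TensorProduct.add_tmul, map_add, hx, hy]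
    | tmul x y => simp [couL, TensorProduct.smul_tmul']
  refine (h1 _).trans ?_
  rw [LinearMap.comp_apply] at h
  rw [h]
  simp

theorem lTensor_couL_coact : LinearMap.lTensor C (couL k C M) ∘ₗ coact k C M = LinearMap.id := by
  refine TensorProduct.ext' fun c m => ?_
  have h := LinearMap.congr_fun (Coalgebra.lTensor_counit_comp_comul (R := k) (A := C)) c
  have h1 : ∀ w, LinearMap.lTensor C (couL k C M) (TensorProduct.assoc k C C M (w ⊗ₜ m)) =
      (TensorProduct.rid k C (LinearMap.lTensor C (cou k C) w)) ⊗ₜ m := by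
    intro w
    induction w with
    | zero => simp
    | add x y hx hy => simp only [TensorProduct.add_tmul, map_add, hx, hy]
    | tmul x y => simp [couL, TensorProduct.smul_tmul']
  refine (h1 _).trans ?_
  rw [LinearMap.comp_apply] at h
  rw [h]
  simp

theorem couL_tmap (n : ℤ) {P Q : Type u} [AddCommGroup P] [Module k P] [AddCommGroup Q]
    [Module k Q] [DGSpace k Q] (α : P →ₗ[k] Q) :
    couL k C Q ∘ₗ tmap n LinearMap.id α = α ∘ₗ
      ((TensorProduct.lid k P).toLinearMap ∘ₗ LinearMap.rTensor P (cou k C)) := by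
  rw [couL, LinearMap.comp_assoc, LinearMap.rTensor, map_comp_tmap]
  have e := tmap_cou (C := C) n LinearMap.id α
  rw [LinearMap.id_comp] at e
  rw [LinearMap.id_comp, LinearMap.comp_id, e]
  ext x y; simp

theorem qMap_pMap (n : ℤ) (α : C ⊗[k] M →ₗ[k] N) : qMap (pMap n α) = α := by
  rw [qMap, pMap, ← LinearMap.comp_assoc, couL_tmap, LinearMap.comp_assoc]
  exact (congrArg (α ∘ₗ ·) (couL_coact (k := k) (C := C) (M := M))).trans (LinearMap.comp_id _)

/-- Maps of left `C`-comodules of degree `n`: `(Δ ⊗ 1) ∘ φ = (1 ⊗ φ) ∘ (Δ ⊗ 1)`. -/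
def IsComodMap (n : ℤ) (φ : C ⊗[k] M →ₗ[k] C ⊗[k] N) : Prop :=
  coact k C N ∘ₗ φ = tmap n LinearMap.id φ ∘ₗ coact k C M

theorem pMap_qMap {n : ℤ} {φ : C ⊗[k] M →ₗ[k] C ⊗[k] N} (h : IsComodMap n φ) :
    pMap n (qMap φ) = φ := by
  have e : tmap n LinearMap.id (qMap φ) = LinearMap.lTensor C (couL k C N) ∘ₗ
      tmap n LinearMap.id φ := by
    rw [LinearMap.lTensor, map_comp_tmap, LinearMap.id_comp]; rfl
  rw [pMap, e, LinearMap.comp_assoc, ← h, ← LinearMap.comp_assoc, lTensor_couL_coact,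
    LinearMap.id_comp]

theorem isComodMap_pMap (n : ℤ) (α : C ⊗[k] M →ₗ[k] N) : IsComodMap n (pMap n α) := by
  have e : tmap n LinearMap.id (pMap n α) = tmap n LinearMap.id (tmap n LinearMap.id α) ∘ₗ
      LinearMap.lTensor C (coact k C M) := by
    rw [LinearMap.lTensor, tmap_comp_map n id_deg, LinearMap.id_comp]; rfl
  rw [IsComodMap, e, LinearMap.comp_assoc, ← coact_coact, pMap, ← LinearMap.comp_assoc,
    coact_tmap, LinearMap.comp_assoc]

theorem IsComodMap.ext {n : ℤ} {φ φ' : C ⊗[k] M →ₗ[k] C ⊗[k] N} (h : IsComodMap n φ)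
    (h' : IsComodMap n φ') (e : qMap φ = qMap φ') : φ = φ' := by
  rw [← pMap_qMap h, e, pMap_qMap h']

end Maps

section Nat

variable {k : Type u} [Field k]
variable {C Ω : Type u} [AddCommGroup C] [Module k C] [DGSpace k C] [Coalgebra k C]
  [AddCommGroup Ω] [Module k Ω] [DGSpace k Ω] [Coalgebra k Ω]
  [IsCCDGCoalgebra k C] [IsCCDGCoalgebra k Ω] [CCDGHopfStr k Ω]

section cotensor

variable {M M' : Type u}
  [AddCommGroup M] [Module k M] [DGSpace k M]
  [AddCommGroup M'] [Module k M'] [DGSpace k M']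

/-- The tensor product `φ ⊗_Δ φ' = (φ ⊗ (ε ⊗ 1) φ') ∘ (1 ⊗ τ ⊗ 1) ∘ (Δ ⊗ 1)`, where `n` is the degree
of `φ'`. -/
noncomputable def cotensor (n : ℤ) (φ : C ⊗[k] M →ₗ[k] C ⊗[k] M)
    (φ' : C ⊗[k] M' →ₗ[k] C ⊗[k] M') : C ⊗[k] (M ⊗[k] M') →ₗ[k] C ⊗[k] (M ⊗[k] M') :=
  (TensorProduct.assoc k C M M').toLinearMap ∘ₗ tmap n φ (qMap φ') ∘ₗ
    midSwap k C M C M' ∘ₗ LinearMap.rTensor (M ⊗[k] M') (com k C)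

theorem qMap_cotensor (n : ℤ) (φ : C ⊗[k] M →ₗ[k] C ⊗[k] M) (φ' : C ⊗[k] M' →ₗ[k] C ⊗[k] M') :
    qMap (cotensor n φ φ') = tmap n (qMap φ) (qMap φ') ∘ₗ midSwap k C M C M' ∘ₗ
      LinearMap.rTensor (M ⊗[k] M') (com k C) := by
  have e : couL k C (M ⊗[k] M') ∘ₗ (TensorProduct.assoc k C M M').toLinearMap =
      LinearMap.rTensor M' (couL k C M) := by
    ext c m m'
    simp [couL, TensorProduct.smul_tmul']
  rw [qMap, cotensor, ← LinearMap.comp_assoc, e, ← LinearMap.comp_assoc, LinearMap.rTensor,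
    map_comp_tmap]
  rfl

theorem coact_midSwap : ((TensorProduct.assoc k C (C ⊗[k] M) (C ⊗[k] M')).toLinearMap ∘ₗ
      LinearMap.rTensor (C ⊗[k] M') (coact k C M)) ∘ₗ midSwap k C M C M' ∘ₗ
      LinearMap.rTensor (M ⊗[k] M') (com k C) =
    LinearMap.lTensor C (midSwap k C M C M' ∘ₗ LinearMap.rTensor (M ⊗[k] M') (com k C)) ∘ₗ
      coact k C (M ⊗[k] M') := by
  refine TensorProduct.ext (LinearMap.ext fun c => tensor_ext_gr fun i j m hm m' hm' => ?_)
  have h := LinearMap.congr_fun (Coalgebra.coassoc (R := k) (A := C)) c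
  let K : C ⊗[k] C →ₗ[k] (C ⊗[k] M) ⊗[k] (C ⊗[k] M') :=
    TensorProduct.map ((TensorProduct.mk k C M).flip m) ((TensorProduct.mk k C M').flip m' ∘ₗ kos i)
  have hK : ∀ w : C ⊗[k] C, midSwap k C M C M' (w ⊗ₜ (m ⊗ₜ m')) = K w := by
    intro w
    have : midSwap k C M C M' ∘ₗ (TensorProduct.mk k (C ⊗[k] C) (M ⊗[k] M')).flip (m ⊗ₜ m') = K := by
      refine tensor_ext_gr fun a b x hx y hy => ?_
      change midSwap k C M C M' ((x ⊗ₜ y) ⊗ₜ (m ⊗ₜ m')) = (x ⊗ₜ m) ⊗ₜ (kos i y ⊗ₜ m')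
      rw [midSwap_tmul _ hy hm, kos_apply i hy, mul_comm, ← TensorProduct.smul_tmul',
        TensorProduct.tmul_smul]
    exact LinearMap.congr_fun this w
  have h1 : ∀ w : C ⊗[k] C, (TensorProduct.assoc k C (C ⊗[k] M) (C ⊗[k] M'))
      (LinearMap.rTensor (C ⊗[k] M') (coact k C M) (K w)) =
      LinearMap.lTensor C K (TensorProduct.assoc k C C C (LinearMap.rTensor C (com k C) w)) := by
    intro w
    induction w with
    | zero => simp
    | add x y hx hy => simp only [map_add, hx, hy]
    | tmul x y =>
      change (TensorProduct.assoc k C (C ⊗[k] M) (C ⊗[k] M'))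
        ((TensorProduct.assoc k C C M (com k C x ⊗ₜ m)) ⊗ₜ (kos i y ⊗ₜ m')) =
        LinearMap.lTensor C K (TensorProduct.assoc k C C C (com k C x ⊗ₜ y))
      generalize com k C x = v
      induction v with
      | zero => simp
      | add x y hx hy => simp only [TensorProduct.add_tmul, map_add, hx, hy]
      | tmul x y => simp [K]
  have h2 : ∀ w : C ⊗[k] C, LinearMap.lTensor C
      (midSwap k C M C M' ∘ₗ LinearMap.rTensor (M ⊗[k] M') (com k C))
      (TensorProduct.assoc k C C (M ⊗[k] M') (w ⊗ₜ (m ⊗ₜ m'))) =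
      LinearMap.lTensor C K (LinearMap.lTensor C (com k C) w) := by
    intro w
    induction w with
    | zero => simp
    | add x y hx hy => simp only [TensorProduct.add_tmul, map_add, hx, hy]
    | tmul x y =>
      simp only [TensorProduct.assoc_tmul, LinearMap.lTensor_tmul, LinearMap.comp_apply,
        LinearMap.rTensor_tmul, hK]
  change (TensorProduct.assoc k C (C ⊗[k] M) (C ⊗[k] M')) (LinearMap.rTensor (C ⊗[k] M')
    (coact k C M) (midSwap k C M C M' (com k C c ⊗ₜ (m ⊗ₜ m')))) = _
  rw [hK, h1]
  exact (congrArg (LinearMap.lTensor C K) h).trans (h2 _).symm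

theorem isComodMap_cotensor {q : ℤ} (r : ℤ) {φ : C ⊗[k] M →ₗ[k] C ⊗[k] M} (hφ : IsComodMap q φ)
    (φ' : C ⊗[k] M' →ₗ[k] C ⊗[k] M') : IsComodMap (q + r) (cotensor r φ φ') := by
  have e1 : coact k C (M ⊗[k] M') ∘ₗ (TensorProduct.assoc k C M M').toLinearMap =
      LinearMap.lTensor C (TensorProduct.assoc k C M M').toLinearMap ∘ₗ
        (TensorProduct.assoc k C (C ⊗[k] M) M').toLinearMap ∘ₗ
          LinearMap.rTensor M' (coact k C M) := by
    ext c m m'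
    change TensorProduct.assoc k C C (M ⊗[k] M') (com k C c ⊗ₜ (m ⊗ₜ m')) =
      LinearMap.lTensor C (TensorProduct.assoc k C M M').toLinearMap
        (TensorProduct.assoc k C (C ⊗[k] M) M'
          ((TensorProduct.assoc k C C M (com k C c ⊗ₜ m)) ⊗ₜ m'))
    generalize com k C c = v
    induction v with
    | zero => simp
    | add x y hx hy => simp only [TensorProduct.add_tmul, map_add, hx, hy]
    | tmul x y => simp
  have e2 : LinearMap.rTensor M' (coact k C M) ∘ₗ tmap r φ (qMap φ') =
      tmap r (tmap q LinearMap.id φ) (qMap φ') ∘ₗ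
        LinearMap.rTensor (C ⊗[k] M') (coact k C M) := by
    rw [LinearMap.rTensor, map_comp_tmap, hφ, LinearMap.rTensor, tmap_comp_map r coact_deg]
    rfl
  have e3 : tmap (q + r) LinearMap.id (cotensor r φ φ') =
      LinearMap.lTensor C (TensorProduct.assoc k C M M').toLinearMap ∘ₗ
      tmap (q + r) LinearMap.id (tmap r φ (qMap φ')) ∘ₗ
      LinearMap.lTensor C (midSwap k C M C M' ∘ₗ LinearMap.rTensor (M ⊗[k] M') (com k C)) := by
    rw [LinearMap.lTensor, LinearMap.lTensor, tmap_comp_map _ id_deg, map_comp_tmap]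
    rfl
  rw [IsComodMap, e3, LinearMap.comp_assoc, LinearMap.comp_assoc, ← coact_midSwap, cotensor,
    ← LinearMap.comp_assoc, e1, LinearMap.comp_assoc, LinearMap.comp_assoc]
  congr 1
  rw [← LinearMap.comp_assoc _ _ (LinearMap.rTensor M' (coact k C M)), e2]
  simp only [← LinearMap.comp_assoc]
  rw [assoc_tmap]

end cotensor

variable (k C Ω) in
/-- Families of linear endomorphisms of `C ⊗ M`, indexed by the left dg-modules `M`. -/
abbrev Fam := ∀ M : DGMod k Ω, C ⊗[k] M.carrier →ₗ[k] C ⊗[k] M.carrier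

/-- The natural endomorphisms of degree `n` of `C ⊗ ω`: the components have degree `n`, are maps of
left `C`-comodules, and commute, up to the Koszul sign, with `1 ⊗ ψ` for all morphisms `ψ` of
dg-modules of all degrees. -/
structure IsNatEnd (n : ℤ) (η : Fam k C Ω) : Prop where
  deg : ∀ M, η M ∈ homDeg k (C ⊗[k] M.carrier) (C ⊗[k] M.carrier) n
  comod : ∀ M, IsComodMap n (η M)
  nat : ∀ (M M' : DGMod k Ω) (m : ℤ) (ψ : M.carrier →ₗ[k] M'.carrier), IsModHom M M' m ψ →
    tmap m LinearMap.id ψ ∘ₗ η M = ((-1 : k) ^ (m * n)) • (η M' ∘ₗ tmap m LinearMap.id ψ)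

/-- Cycles of degree `0` that are compatible with the tensor structure. -/
structure IsTensorEnd (η : Fam k C Ω) : Prop extends IsNatEnd 0 η where
  closed : ∀ M, homDif 0 (η M) = 0
  unit : η (DGMod.triv k Ω) = LinearMap.id
  tensor : ∀ M M', η (M.tensor M') = cotensor 0 (η M) (η M')

/-- Homotopy pairs `(η(t), λ(t))` of polynomials whose coefficients are natural endomorphisms of
degree `0` and `1`: `d/dt η(t) = δ λ(t)`, `η(0)` is a tensor natural endomorphism and a cycle,
`λ(t)_k = 0`, and `λ(t)_{M ⊗ M'} = λ(t)_M ⊗_Δ η(t)_{M'} + η(t)_M ⊗_Δ λ(t)_{M'}`. All identities are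
written coefficientwise in `t`. -/
structure IsTensorHtpyPair (η l : ℕ →₀ Fam k C Ω) : Prop where
  η_nat : ∀ i, IsNatEnd 0 (η i)
  l_nat : ∀ i, IsNatEnd 1 (l i)
  deriv : ∀ (i : ℕ) M, ((i : k) + 1) • η (i + 1) M = homDif 1 (l i M)
  start : IsTensorEnd (η 0)
  unit : ∀ i, l i (DGMod.triv k Ω) = 0
  tensor : ∀ i M M', l i (M.tensor M') = ∑ p ∈ Finset.HasAntidiagonal.antidiagonal i,
    (cotensor 0 (l p.1 M) (η p.2 M') + cotensor 1 (η p.1 M) (l p.2 M'))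

/-- `η` and `η'` are joined by a homotopy pair with values `η` at `0` and `η'` at `1`. -/
def TensorHomotopic (η η' : Fam k C Ω) : Prop :=
  ∃ e l : ℕ →₀ Fam k C Ω, IsTensorHtpyPair e l ∧ e 0 = η ∧ (e.sum fun _ a => a) = η'

/-- The family `(1 ⊗ γ) ∘ (1 ⊗ a ⊗ 1) ∘ (Δ ⊗ 1)` attached to a linear map `a : C → Ω` of degree `n`. -/
noncomputable def ofMap (n : ℤ) : (C →ₗ[k] Ω) →ₗ[k] Fam k C Ω where
  toFun a M := pMap n (M.act ∘ₗ LinearMap.rTensor M.carrier a)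
  map_add' a b := by
    ext M x; simp [pMap, tmap, LinearMap.rTensor_add, LinearMap.comp_add, TensorProduct.map_add_right]
  map_smul' c a := by
    ext M x; simp [pMap, tmap, LinearMap.rTensor_smul, LinearMap.comp_smul, TensorProduct.map_smul_right]

theorem qMap_ofMap (n : ℤ) (a : C →ₗ[k] Ω) (M : DGMod k Ω) :
    qMap (ofMap n a M) = M.act ∘ₗ LinearMap.rTensor M.carrier a := qMap_pMap _ _

/-- The linear map `c ↦ (ε ⊗ 1) (η_Ω (c ⊗ 1))`. -/
noncomputable def toMap : Fam k C Ω →ₗ[k] (C →ₗ[k] Ω) where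
  toFun η := qMap (η (DGMod.self k Ω)) ∘ₗ LinearMap.lTensor C (hone k Ω) ∘ₗ
    (TensorProduct.rid k C).symm.toLinearMap
  map_add' a b := by ext x; simp [qMap]
  map_smul' c a := by ext x; simp [qMap]

theorem toMap_ofMap (n : ℤ) (a : C →ₗ[k] Ω) : toMap (ofMap n a) = a := by
  change qMap (ofMap n a (DGMod.self k Ω)) ∘ₗ LinearMap.lTensor C (hone k Ω) ∘ₗ
    (TensorProduct.rid k C).symm.toLinearMap = a
  rw [qMap_ofMap]
  ext x
  have := LinearMap.congr_fun (CCDGHopfStr.mul_one (k := k) (Ω := Ω)) (a x ⊗ₜ 1)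
  simpa using this

theorem act_rTensor_deg {n : ℤ} {a : C →ₗ[k] Ω} (h : a ∈ homDeg k C Ω n) (M : DGMod k Ω) :
    M.act ∘ₗ LinearMap.rTensor M.carrier a ∈ homDeg k (C ⊗[k] M.carrier) M.carrier n := by
  have := tmap_deg n 0 0 h (id_deg (k := k) (V := M.carrier))
  rw [tmap_zero_deg, add_zero] at this
  exact comp_deg (add_zero n) this M.act_deg

theorem homDif_ofMap {n : ℤ} {a : C →ₗ[k] Ω} (h : a ∈ homDeg k C Ω n) (M : DGMod k Ω) :
    homDif n (ofMap n a M) = ofMap (n - 1) (homDif n a) M := by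
  change homDif n (pMap n _) = pMap (n - 1) _
  rw [homDif_pMap, homDif_comp_left n _ M.act_chain, LinearMap.rTensor, ← tmap_zero_deg,
    homDif_tmap_left n h isChain_id, tmap_zero_deg]
  rfl

theorem isNatEnd_ofMap {n : ℤ} {a : C →ₗ[k] Ω} (h : a ∈ homDeg k C Ω n) :
    IsNatEnd n (ofMap n a) where
  deg M := pMap_deg (act_rTensor_deg h M)
  comod M := isComodMap_pMap _ _
  nat M M' m ψ hψ := by
    change tmap m LinearMap.id ψ ∘ₗ tmap n LinearMap.id (M.act ∘ₗ LinearMap.rTensor _ a) ∘ₗ _ =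
      _ • ((tmap n LinearMap.id (M'.act ∘ₗ LinearMap.rTensor _ a) ∘ₗ coact k C _) ∘ₗ _)
    rw [← LinearMap.comp_assoc, tmap_comp_tmap_id, ← LinearMap.comp_assoc, hψ.2,
      LinearMap.comp_assoc, LinearMap.rTensor, tmap_id_comp_map m n h, LinearMap.comp_id,
      LinearMap.comp_assoc, coact_tmap, ← LinearMap.comp_assoc (coact k C _), tmap_comp_tmap_id,
      LinearMap.comp_assoc, LinearMap.rTensor, map_comp_tmap, LinearMap.comp_id,
      LinearMap.id_comp, add_comm n m, LinearMap.comp_smul]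
    ext x
    simp [tmap, TensorProduct.map_smul_right]

/-- The map `ω ↦ (-1) ^ (m * |ω|) ω z`. -/
noncomputable def orbit (M : DGMod k Ω) (m : ℤ) (z : M.carrier) : Ω →ₗ[k] M.carrier :=
  M.act ∘ₗ (TensorProduct.mk k Ω M.carrier).flip z ∘ₗ kos m

theorem orbit_apply (M : DGMod k Ω) (m : ℤ) (z : M.carrier) {i : ℤ} {x : Ω} (hx : x ∈ gr k Ω i) :
    orbit M m z x = ((-1 : k) ^ (m * i)) • M.act (x ⊗ₜ z) := by
  simp [orbit, kos_apply m hx]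

theorem isModHom_orbit (M : DGMod k Ω) {m : ℤ} {z : M.carrier} (hz : z ∈ gr k M.carrier m) :
    IsModHom (DGMod.self k Ω) M m (orbit M m z) := by
  constructor
  · intro i x hx
    rw [orbit_apply M m z hx]
    have := M.act_deg _ _ (tmul_mem rfl hx hz)
    rw [add_zero] at this
    exact Submodule.smul_mem _ _ this
  · refine tensor_ext_gr fun i j x hx y hy => ?_
    have h := LinearMap.congr_fun M.act_mul ((x ⊗ₜ y) ⊗ₜ z)
    simp only [LinearMap.comp_apply, LinearMap.rTensor_tmul, LinearMap.lTensor_tmul,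
      LinearEquiv.coe_coe, TensorProduct.assoc_tmul] at h
    have hxy : hmul k Ω (x ⊗ₜ y) ∈ gr k Ω (i + j) := by
      have := CCDGHopfStr.mul_deg (k := k) (Ω := Ω) _ _ (tmul_mem rfl hx hy)
      rwa [add_zero] at this
    rw [LinearMap.comp_apply, LinearMap.comp_apply, tmap_tmul m _ _ hx]
    change orbit M m z (hmul k Ω (x ⊗ₜ y)) = _
    rw [orbit_apply M m z hxy, orbit_apply M m z hy, h, TensorProduct.tmul_smul, map_smul, map_smul,
      smul_smul, ← zpow_add₀ (by simp), mul_add]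
    rfl

theorem orbit_one (M : DGMod k Ω) (m : ℤ) (z : M.carrier) : orbit M m z (hone k Ω 1) = z := by
  have h := LinearMap.congr_fun M.act_one (1 ⊗ₜ z)
  simp only [LinearMap.comp_apply, LinearMap.rTensor_tmul, LinearEquiv.coe_coe,
    TensorProduct.lid_tmul, one_smul] at h
  rw [orbit_apply M m z (i := 0)
    (by simpa using CCDGHopfStr.one_deg (k := k) (Ω := Ω) _ _ (mem_gr_field 1)), h]
  simp

theorem toMap_apply (η : Fam k C Ω) (c : C) :
    toMap η c = qMap (η (DGMod.self k Ω)) (c ⊗ₜ hone k Ω 1) := by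
  simp [toMap]

theorem toMap_deg {n : ℤ} {η : Fam k C Ω} (h : IsNatEnd n η) : toMap η ∈ homDeg k C Ω n := by
  intro i c hc
  rw [toMap_apply]
  have h1 : hone k Ω 1 ∈ gr k Ω 0 := by
    simpa using CCDGHopfStr.one_deg (k := k) (Ω := Ω) _ _ (mem_gr_field 1)
  exact qMap_deg (h.deg (DGMod.self k Ω)) _ _
    (tmul_mem (W := (DGMod.self k Ω).carrier) (add_zero i) hc h1)

theorem ofMap_toMap {n : ℤ} {η : Fam k C Ω} (h : IsNatEnd n η) : ofMap n (toMap η) = η := by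
  funext M
  refine (isComodMap_pMap _ _).ext (h.comod M) ?_
  rw [qMap_pMap]
  refine tensor_ext_gr fun i m c hc z hz => ?_
  have h1 := LinearMap.congr_fun (congrArg (couL k C M.carrier ∘ₗ ·)
    (h.nat _ M m _ (isModHom_orbit M hz))) (c ⊗ₜ hone k Ω 1)
  dsimp only at h1
  rw [← LinearMap.comp_assoc, couL_tmap] at h1
  simp only [LinearMap.comp_apply, LinearMap.smul_apply, tmap_tmul m _ _ hc, orbit_one,
    LinearMap.id_apply, map_smul, smul_smul] at h1
  have h2 : orbit M m z (toMap η c) = ((-1 : k) ^ (m * n) * (-1 : k) ^ (m * i)) •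
    qMap (η M) (c ⊗ₜ z) := by rw [toMap_apply]; exact h1
  rw [orbit_apply M m z (toMap_deg h i c hc), mul_add, zpow_add₀ (by simp),
    mul_comm ((-1 : k) ^ (m * i))] at h2
  exact smul_right_injective _ (by simp [zpow_ne_zero]) h2

theorem qMap_ofMap_tensor (n : ℤ) (a : C →ₗ[k] Ω) (M M' : DGMod k Ω) :
    qMap (ofMap n a (M.tensor M')) = act₂ M.act M'.act ∘ₗ
      LinearMap.rTensor (M.carrier ⊗[k] M'.carrier) (com k Ω ∘ₗ a) := by
  rw [qMap_ofMap, LinearMap.rTensor_comp, ← LinearMap.comp_assoc]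

theorem qMap_cotensor_ofMap (q : ℤ) {r : ℤ} (b : C →ₗ[k] Ω) {c : C →ₗ[k] Ω}
    (hc : c ∈ homDeg k C Ω r) (M M' : DGMod k Ω) :
    qMap (cotensor r (ofMap q b M) (ofMap r c M')) = act₂ M.act M'.act ∘ₗ
      LinearMap.rTensor (M.carrier ⊗[k] M'.carrier) (tmap r b c ∘ₗ com k C) := by
  have e := midSwap_tmap r 0 0 b (LinearMap.id : M'.carrier →ₗ[k] M'.carrier) hc
    (id_deg (k := k) (V := M.carrier))
  simp only [mul_zero, zpow_zero, one_smul, add_zero, tmap_zero_deg, TensorProduct.map_id] at e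
  rw [qMap_cotensor, qMap_ofMap, qMap_ofMap, act₂, ← map_comp_tmap, LinearMap.rTensor_comp,
    LinearMap.comp_assoc, LinearMap.comp_assoc]
  congr 1
  simp only [← LinearMap.comp_assoc]
  congr 1
  exact e.symm

theorem act₂_self_injective {w w' : C →ₗ[k] Ω ⊗[k] Ω}
    (h : act₂ (hmul k Ω) (hmul k Ω) ∘ₗ LinearMap.rTensor (Ω ⊗[k] Ω) w =
      act₂ (hmul k Ω) (hmul k Ω) ∘ₗ LinearMap.rTensor (Ω ⊗[k] Ω) w') : w = w' := by
  have e := act₂_mul_one (CCDGHopfStr.one_deg (k := k) (Ω := Ω)) CCDGHopfStr.mul_one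
  ext c
  have e1 := LinearMap.congr_fun e (w c ⊗ₜ 1)
  have e2 := LinearMap.congr_fun e (w' c ⊗ₜ 1)
  have h1 := LinearMap.congr_fun h (c ⊗ₜ ((TensorProduct.map (hone k Ω) (hone k Ω) ∘ₗ
      (TensorProduct.lid k k).symm.toLinearMap) 1))
  have h2 := (e1.symm.trans h1).trans e2
  simpa using h2

theorem IsComodMap.sum {M N : Type u} [AddCommGroup M] [Module k M] [DGSpace k M]
    [AddCommGroup N] [Module k N] [DGSpace k N] {ι : Type*} (s : Finset ι) (n : ℤ)
    {φ : ι → (C ⊗[k] M →ₗ[k] C ⊗[k] N)} (h : ∀ i, IsComodMap n (φ i)) :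
    IsComodMap n (∑ i ∈ s, φ i) := by
  have e : ∀ x, ∑ i ∈ s, φ i = x → x = ∑ i ∈ s, pMap n (qMap (φ i)) := by
    rintro _ rfl; exact Finset.sum_congr rfl fun i _ => (pMap_qMap (h i)).symm
  rw [e _ rfl]
  have : ∑ i ∈ s, pMap n (qMap (φ i)) = pMap n (∑ i ∈ s, qMap (φ i)) := by
    let L : (C ⊗[k] M →ₗ[k] N) →ₗ[k] (C ⊗[k] M →ₗ[k] C ⊗[k] N) :=
      { toFun := fun α => pMap n α
        map_add' := fun a b => by ext; simp [pMap, tmap, TensorProduct.map_add_right]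
        map_smul' := fun c a => by ext; simp [pMap, tmap, TensorProduct.map_smul_right] }
    exact (map_sum L _ _).symm
  rw [this]
  exact isComodMap_pMap _ _

theorem ofMap_unit_iff (a : C →ₗ[k] Ω) :
    ofMap 0 a (DGMod.triv k Ω) = LinearMap.id ↔ cou k Ω ∘ₗ a = cou k C := by
  have hid : IsComodMap 0 (LinearMap.id : C ⊗[k] k →ₗ[k] C ⊗[k] k) := by
    simp [IsComodMap, tmap_zero_deg]
  have e : qMap (ofMap 0 a (DGMod.triv k Ω)) =
      (TensorProduct.lid k k).toLinearMap ∘ₗ LinearMap.rTensor k (cou k Ω ∘ₗ a) := by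
    rw [qMap_ofMap, LinearMap.rTensor_comp]; rfl
  constructor
  · intro h
    rw [h] at e
    ext c
    have := LinearMap.congr_fun e (c ⊗ₜ 1)
    simpa [qMap, couL] using this.symm
  · intro h
    refine (isComodMap_pMap _ _).ext hid ?_
    exact e.trans (by rw [h]; rfl)

theorem ofMap_unit_zero_iff (n : ℤ) (a : C →ₗ[k] Ω) :
    ofMap n a (DGMod.triv k Ω) = 0 ↔ cou k Ω ∘ₗ a = 0 := by
  have hid : IsComodMap n (0 : C ⊗[k] k →ₗ[k] C ⊗[k] k) := by
    simp [IsComodMap, tmap]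
  have e : qMap (ofMap n a (DGMod.triv k Ω)) =
      (TensorProduct.lid k k).toLinearMap ∘ₗ LinearMap.rTensor k (cou k Ω ∘ₗ a) := by
    rw [qMap_ofMap, LinearMap.rTensor_comp]; rfl
  constructor
  · intro h
    rw [h] at e
    ext c
    have := LinearMap.congr_fun e (c ⊗ₜ 1)
    simpa [qMap, couL] using this.symm
  · intro h
    refine (isComodMap_pMap _ _).ext hid ?_
    exact e.trans (by rw [h]; simp [qMap])

theorem ofMap_injective {n : ℤ} {a b : C →ₗ[k] Ω} (h : ofMap n a = ofMap n b) : a = b := by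
  rw [← toMap_ofMap n a, h, toMap_ofMap]

theorem isTensorEnd_ofMap_iff (a : C →ₗ[k] Ω) (ha : a ∈ homDeg k C Ω 0) :
    IsTensorEnd (ofMap 0 a) ↔ IsCoalgHom a := by
  constructor
  · intro h
    refine ⟨ha, ?_, (ofMap_unit_iff a).1 h.unit, ?_⟩
    · refine ofMap_injective (n := 0 - 1) ?_
      rw [map_zero]
      funext M
      rw [← homDif_ofMap ha]
      exact h.closed M
    · have := congrArg qMap (h.tensor (DGMod.self k Ω) (DGMod.self k Ω))
      rw [qMap_ofMap_tensor, qMap_cotensor_ofMap 0 a ha] at this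
      exact act₂_self_injective this
  · intro h
    refine ⟨isNatEnd_ofMap h.deg, ?_, (ofMap_unit_iff a).2 h.counit, ?_⟩
    · intro M
      rw [homDif_ofMap h.deg, h.chain, map_zero]; rfl
    · intro M M'
      refine (isComodMap_pMap _ _).ext (isComodMap_cotensor (q := 0) 0 (isComodMap_pMap _ _) _) ?_
      refine (qMap_ofMap_tensor 0 a M M').trans ?_
      rw [h.comul, ← qMap_cotensor_ofMap 0 a ha]

theorem qMap_sum {M N : Type u} [AddCommGroup M] [Module k M] [DGSpace k M]
    [AddCommGroup N] [Module k N] [DGSpace k N] {ι : Type*} (s : Finset ι)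
    (φ : ι → (C ⊗[k] M →ₗ[k] C ⊗[k] N)) : qMap (∑ i ∈ s, φ i) = ∑ i ∈ s, qMap (φ i) := by
  ext x y; simp [qMap]

theorem ofMap_tensor_sum_iff {ι : Type} (s : Finset ι) (x : C →ₗ[k] Ω) (f ξ f' ξ' : ι → (C →ₗ[k] Ω))
    (hf : ∀ i, f' i ∈ homDeg k C Ω 0) (hξ : ∀ i, ξ' i ∈ homDeg k C Ω 1) :
    (∀ M M', ofMap 1 x (DGMod.tensor M M') = ∑ i ∈ s,
      (cotensor 0 (ofMap 1 (ξ i) M) (ofMap 0 (f' i) M') +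
        cotensor 1 (ofMap 0 (f i) M) (ofMap 1 (ξ' i) M'))) ↔
    com k Ω ∘ₗ x = ∑ i ∈ s, (tmap 1 (f i) (ξ' i) + tmap 0 (ξ i) (f' i)) ∘ₗ com k C := by
  have key : ∀ M M' : DGMod k Ω, qMap (∑ i ∈ s,
      (cotensor 0 (ofMap 1 (ξ i) M) (ofMap 0 (f' i) M') +
        cotensor 1 (ofMap 0 (f i) M) (ofMap 1 (ξ' i) M'))) = act₂ M.act M'.act ∘ₗ
      LinearMap.rTensor (M.carrier ⊗[k] M'.carrier)
        (∑ i ∈ s, (tmap 1 (f i) (ξ' i) + tmap 0 (ξ i) (f' i)) ∘ₗ com k C) := by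
    intro M M'
    have e : LinearMap.rTensor (M.carrier ⊗[k] M'.carrier)
        (∑ i ∈ s, (tmap 1 (f i) (ξ' i) + tmap 0 (ξ i) (f' i)) ∘ₗ com k C) =
      ∑ i ∈ s, LinearMap.rTensor (M.carrier ⊗[k] M'.carrier)
        ((tmap 1 (f i) (ξ' i) + tmap 0 (ξ i) (f' i)) ∘ₗ com k C) :=
      map_sum (LinearMap.rTensorHom (R := k) (M.carrier ⊗[k] M'.carrier)) _ _
    have e' : ∀ φ : ι → (C ⊗[k] (M.carrier ⊗[k] M'.carrier) →ₗ[k]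
        (Ω ⊗[k] Ω) ⊗[k] (M.carrier ⊗[k] M'.carrier)),
        act₂ M.act M'.act ∘ₗ (∑ i ∈ s, φ i) = ∑ i ∈ s, act₂ M.act M'.act ∘ₗ φ i := by
      intro φ
      exact map_sum (LinearMap.llcomp k _ _ _ (act₂ M.act M'.act)) _ _
    rw [qMap_sum, e, e']
    refine Finset.sum_congr rfl fun i _ => ?_
    rw [LinearMap.add_comp, LinearMap.rTensor_add, LinearMap.comp_add,
      ← qMap_cotensor_ofMap 0 (f i) (hξ i), ← qMap_cotensor_ofMap 1 (ξ i) (hf i), add_comm]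
    exact LinearMap.comp_add _ _ _
  constructor
  · intro h
    have := congrArg qMap (h (DGMod.self k Ω) (DGMod.self k Ω))
    rw [qMap_ofMap_tensor, key] at this
    exact act₂_self_injective this
  · intro h M M'
    refine (isComodMap_pMap _ _).ext (IsComodMap.sum _ _ fun i => ?_) ?_
    · have h1 := isComodMap_cotensor (q := 1) 0 (isComodMap_pMap 1 (M.act ∘ₗ
        LinearMap.rTensor M.carrier (ξ i))) (ofMap 0 (f' i) M')
      have h2 := isComodMap_cotensor (q := 0) 1 (isComodMap_pMap 0 (M.act ∘ₗ
        LinearMap.rTensor M.carrier (f i))) (ofMap 1 (ξ' i) M')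
      rw [add_zero] at h1
      rw [zero_add] at h2
      have := IsComodMap.sum (Finset.univ : Finset Bool) 1
        (φ := fun b => if b then cotensor 0 (ofMap 1 (ξ i) M) (ofMap 0 (f' i) M') else
          cotensor 1 (ofMap 0 (f i) M) (ofMap 1 (ξ' i) M'))
        (fun b => by cases b; exacts [h2, h1])
      simpa using this
    · exact (qMap_ofMap_tensor 1 x M M').trans (by rw [h, ← key])

theorem isTensorHtpyPair_ofMap_iff (f ξ : ℕ →₀ (C →ₗ[k] Ω)) (hf : ∀ i, f i ∈ homDeg k C Ω 0)
    (hξ : ∀ i, ξ i ∈ homDeg k C Ω 1) :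
    IsTensorHtpyPair (Finsupp.mapRange.linearMap (ofMap 0) f)
      (Finsupp.mapRange.linearMap (ofMap 1) ξ) ↔ IsHtpyPair f ξ := by
  have aux : ∀ i : ℕ, (∀ M : DGMod k Ω, ((i : k) + 1) • ofMap 0 (f (i + 1)) M =
      homDif 1 (ofMap 1 (ξ i) M)) ↔ ((i : k) + 1) • f (i + 1) = homDif 1 (ξ i) := by
    intro i
    constructor
    · intro h
      refine ofMap_injective (n := 0) ?_
      rw [map_smul]
      funext M
      exact (h M).trans (homDif_ofMap (hξ i) M)
    · intro h M
      rw [homDif_ofMap (hξ i), ← h, map_smul]; rfl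
  have aux₂ := fun i => ofMap_tensor_sum_iff (Finset.HasAntidiagonal.antidiagonal i) (ξ i)
    (fun p => f p.1) (fun p => ξ p.1) (fun p => f p.2) (fun p => ξ p.2) (fun p => hf p.2)
    (fun p => hξ p.2)
  have e0 : ∀ i, Finsupp.mapRange.linearMap (ofMap 0) f i = ofMap 0 (f i) := fun i => by
    rw [Finsupp.mapRange.linearMap_apply, Finsupp.mapRange_apply]
  have e1 : ∀ i, Finsupp.mapRange.linearMap (ofMap 1) ξ i = ofMap 1 (ξ i) := fun i => by
    rw [Finsupp.mapRange.linearMap_apply, Finsupp.mapRange_apply]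
  constructor
  · intro h
    refine ⟨hf, hξ, fun i => (aux i).1 fun M => ?_, ?_, fun i => ?_, fun i => (aux₂ i).1 fun M M' => ?_⟩
    · rw [← e0, ← e1]; exact h.deriv i M
    · rw [← isTensorEnd_ofMap_iff _ (hf 0), ← e0]; exact h.start
    · rw [← ofMap_unit_zero_iff 1, ← e1]; exact h.unit i
    · simp only [← e0, ← e1]; exact h.tensor i M M'
  · intro h
    refine ⟨fun i => ?_, fun i => ?_, fun i M => ?_, ?_, fun i => ?_, fun i M M' => ?_⟩
    · rw [e0]; exact isNatEnd_ofMap (hf i)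
    · rw [e1]; exact isNatEnd_ofMap (hξ i)
    · rw [e0, e1]; exact (aux i).2 (h.deriv i) M
    · rw [e0]; exact (isTensorEnd_ofMap_iff _ (hf 0)).2 h.start
    · rw [e1]; exact (ofMap_unit_zero_iff 1 _).2 (h.counit i)
    · simp only [e0, e1]; exact (aux₂ i).2 (h.comul i) M M'

theorem tensorHomotopic_ofMap_iff (a b : C →ₗ[k] Ω) :
    TensorHomotopic (ofMap 0 a) (ofMap 0 b) ↔ Homotopic a b := by
  constructor
  · rintro ⟨e, l, h, he, hs⟩
    have he' : Finsupp.mapRange.linearMap (ofMap 0) (Finsupp.mapRange.linearMap toMap e) = e := by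
      ext1 i
      simp only [Finsupp.mapRange.linearMap_apply, Finsupp.mapRange_apply]
      exact ofMap_toMap (h.η_nat i)
    have hl' : Finsupp.mapRange.linearMap (ofMap 1) (Finsupp.mapRange.linearMap toMap l) = l := by
      ext1 i
      simp only [Finsupp.mapRange.linearMap_apply, Finsupp.mapRange_apply]
      exact ofMap_toMap (h.l_nat i)
    refine ⟨Finsupp.mapRange.linearMap toMap e, Finsupp.mapRange.linearMap toMap l, ?_, ?_, ?_⟩
    · rw [← isTensorHtpyPair_ofMap_iff, he', hl']
      · exact h
      · intro i
        simpa using toMap_deg (h.η_nat i)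
      · intro i
        simpa using toMap_deg (h.l_nat i)
    · simp [he, toMap_ofMap]
    · rw [sum_mapRange, hs, toMap_ofMap]
  · rintro ⟨f, ξ, h, rfl, rfl⟩
    exact ⟨_, _, (isTensorHtpyPair_ofMap_iff f ξ h.f_deg h.ξ_deg).2 h, by simp, sum_mapRange _ f⟩

theorem ofMap_conv (a b : C →ₗ[k] Ω) (M : DGMod k Ω) :
    ofMap 0 (convol 0 a b) M = ofMap 0 a M ∘ₗ ofMap 0 b M := by
  have hc : IsComodMap 0 (ofMap 0 a M ∘ₗ ofMap 0 b M) := by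
    have h1 := isComodMap_pMap 0 (M.act ∘ₗ LinearMap.rTensor M.carrier a)
    have h2 := isComodMap_pMap 0 (M.act ∘ₗ LinearMap.rTensor M.carrier b)
    change IsComodMap 0 (ofMap 0 a M) at h1
    change IsComodMap 0 (ofMap 0 b M) at h2
    rw [IsComodMap] at h1 h2 ⊢
    rw [← LinearMap.comp_assoc, h1, LinearMap.comp_assoc, h2, tmap_zero_deg, tmap_zero_deg,
      tmap_zero_deg, ← LinearMap.comp_assoc, ← TensorProduct.map_comp, LinearMap.comp_id]
  refine (isComodMap_pMap _ _).ext hc ?_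
  rw [qMap_pMap]
  have e : qMap (ofMap 0 a M ∘ₗ ofMap 0 b M) = qMap (ofMap 0 a M) ∘ₗ ofMap 0 b M := rfl
  rw [e, qMap_ofMap]
  change _ = (M.act ∘ₗ LinearMap.rTensor M.carrier a) ∘ₗ tmap 0 LinearMap.id
    (M.act ∘ₗ LinearMap.rTensor M.carrier b) ∘ₗ coact k C M.carrier
  rw [convol, cv, LinearMap.rTensor_comp, ← LinearMap.comp_assoc, M.act_mul]
  refine TensorProduct.ext' fun c m => ?_
  simp only [LinearMap.comp_apply, LinearMap.rTensor_tmul, LinearEquiv.coe_coe, tmap_zero_deg,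
    coact]
  generalize com k C c = w
  induction w with
  | zero => simp
  | add x y hx hy => simp only [TensorProduct.add_tmul, map_add, hx, hy]
  | tmul x y => simp

theorem ofMap_convOne (M : DGMod k Ω) : ofMap 0 (convOne k C Ω) M = LinearMap.id := by
  have hid : IsComodMap 0 (LinearMap.id : C ⊗[k] M.carrier →ₗ[k] C ⊗[k] M.carrier) := by
    simp [IsComodMap, tmap_zero_deg]
  refine (isComodMap_pMap _ _).ext hid ?_
  rw [qMap_pMap, convOne, LinearMap.rTensor_comp, ← LinearMap.comp_assoc, M.act_one]
  rfl

/-- The restriction of a family along `f : B → C`, with components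
`(1 ⊗ (ε ⊗ 1) η_M) ∘ (1 ⊗ f ⊗ 1) ∘ (Δ ⊗ 1)`. -/
noncomputable def Fam.pull {B : Type u} [AddCommGroup B] [Module k B] [DGSpace k B] [Coalgebra k B]
    (f : B →ₗ[k] C) (η : Fam k C Ω) : Fam k B Ω :=
  fun M => pMap 0 (qMap (η M) ∘ₗ LinearMap.rTensor M.carrier f)

theorem pull_ofMap {B : Type u} [AddCommGroup B] [Module k B] [DGSpace k B] [Coalgebra k B]
    (f : B →ₗ[k] C) (a : C →ₗ[k] Ω) : (ofMap 0 a).pull f = ofMap 0 (a ∘ₗ f) := by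
  funext M
  change pMap 0 (qMap (ofMap 0 a M) ∘ₗ _) = pMap 0 _
  rw [qMap_ofMap, LinearMap.rTensor_comp, LinearMap.comp_assoc]

end Nat

section TannakaPresheaf

variable {k : Type u} [Field k]

/-- The degree zero cycles of the tensor natural endomorphisms of `C ⊗ ω`. -/
def TensorEnd (C : CCDGCoalg k) (Ω : CCDGHopf k) : Type (u + 1) :=
  {η : Fam k C.carrier Ω.carrier // IsTensorEnd η}

variable {C : CCDGCoalg k} {Ω : CCDGHopf k}

theorem TensorEnd.exists_ofMap (η : TensorEnd C Ω) :
    ∃ g : C ⟶ Ω.toCCDGCoalg, η.1 = ofMap 0 g.1 := by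
  have h := ofMap_toMap η.2.toIsNatEnd
  refine ⟨⟨toMap η.1, ?_⟩, h.symm⟩
  rw [← isTensorEnd_ofMap_iff _ (toMap_deg η.2.toIsNatEnd), h]
  exact η.2

theorem isTensorEnd_ofMap (g : C ⟶ Ω.toCCDGCoalg) :
    IsTensorEnd (ofMap 0 g.1 : Fam k C.carrier Ω.carrier) :=
  (isTensorEnd_ofMap_iff _ g.2.deg).2 g.2

theorem IsTensorEnd.comp (η η' : TensorEnd C Ω) : IsTensorEnd fun M => η.1 M ∘ₗ η'.1 M := by
  obtain ⟨g, hg⟩ := η.exists_ofMap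
  obtain ⟨h, hh⟩ := η'.exists_ofMap
  rw [hg, hh]
  have := isTensorEnd_ofMap (g * h)
  rwa [show (ofMap 0 (g * h).1 : Fam k C.carrier Ω.carrier) = fun M => _ from
    funext (ofMap_conv g.1 h.1)] at this

theorem IsTensorEnd.id : IsTensorEnd (fun _ => LinearMap.id : Fam k C.carrier Ω.carrier) := by
  have := isTensorEnd_ofMap (1 : C ⟶ Ω.toCCDGCoalg)
  rwa [show (ofMap 0 (1 : C ⟶ Ω.toCCDGCoalg).1 : Fam k C.carrier Ω.carrier) = fun M => _ from
    funext ofMap_convOne] at this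

theorem IsTensorEnd.pull {B : CCDGCoalg k} (f : B ⟶ C) (η : TensorEnd C Ω) :
    IsTensorEnd (η.1.pull f.1) := by
  obtain ⟨g, hg⟩ := η.exists_ofMap
  rw [hg, pull_ofMap]
  exact isTensorEnd_ofMap (f ≫ g)

/-- Tensor natural endomorphisms form a group under composition. -/
noncomputable instance tensorEndGroup : Group (TensorEnd C Ω) where
  mul η η' := ⟨fun M => η.1 M ∘ₗ η'.1 M, IsTensorEnd.comp η η'⟩
  one := ⟨fun _ => LinearMap.id, IsTensorEnd.id⟩
  inv η := ⟨ofMap 0 (hanti k Ω.carrier ∘ₗ toMap η.1), by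
    obtain ⟨g, hg⟩ := η.exists_ofMap
    rw [hg, toMap_ofMap]
    exact isTensorEnd_ofMap g⁻¹⟩
  mul_assoc _ _ _ := rfl
  one_mul _ := rfl
  mul_one _ := rfl
  inv_mul_cancel η := by
    obtain ⟨g, hg⟩ := η.exists_ofMap
    refine Subtype.ext (funext fun M => ?_)
    change ofMap 0 (hanti k Ω.carrier ∘ₗ toMap η.1) M ∘ₗ η.1 M = LinearMap.id
    rw [hg, toMap_ofMap, ← ofMap_conv, hanti_conv g.2, ofMap_convOne]

/-- The homotopy relation. -/
def TensorEnd.Rel (η η' : TensorEnd C Ω) : Prop := TensorHomotopic η.1 η'.1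

theorem TensorEnd.mul_left (a b c : TensorEnd C Ω) (h : Rel b c) : Rel (a * b) (a * c) := by
  obtain ⟨f, hf⟩ := a.exists_ofMap
  obtain ⟨g, hg⟩ := b.exists_ofMap
  obtain ⟨g', hg'⟩ := c.exists_ofMap
  change TensorHomotopic (fun M => a.1 M ∘ₗ b.1 M) (fun M => a.1 M ∘ₗ c.1 M)
  change TensorHomotopic b.1 c.1 at h
  rw [hg, hg', tensorHomotopic_ofMap_iff] at h
  rw [hf, hg, hg', ← funext (ofMap_conv f.1 g.1), ← funext (ofMap_conv f.1 g'.1)]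
  exact (tensorHomotopic_ofMap_iff _ _).2 (h.mul_left f.2)

theorem TensorEnd.mul_right (a b c : TensorEnd C Ω) (h : Rel a b) : Rel (a * c) (b * c) := by
  obtain ⟨f, hf⟩ := c.exists_ofMap
  obtain ⟨g, hg⟩ := a.exists_ofMap
  obtain ⟨g', hg'⟩ := b.exists_ofMap
  change TensorHomotopic (fun M => a.1 M ∘ₗ c.1 M) (fun M => b.1 M ∘ₗ c.1 M)
  change TensorHomotopic a.1 b.1 at h
  rw [hg, hg', tensorHomotopic_ofMap_iff] at h
  rw [hf, hg, hg', ← funext (ofMap_conv g.1 f.1), ← funext (ofMap_conv g'.1 f.1)]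
  exact (tensorHomotopic_ofMap_iff _ _).2 (h.mul_right f.2)

/-- The group of homotopy types of tensor natural endomorphisms, with product
`[η] [η'] = [η ∘ η']`. -/
noncomputable instance tensorEndQuotGroup : Group (Quot (TensorEnd.Rel (C := C) (Ω := Ω))) :=
  quotGroup _ TensorEnd.mul_left TensorEnd.mul_right

/-- The restriction homomorphism along a morphism of ccdg-coalgebras. -/
noncomputable def TensorEnd.res {B : CCDGCoalg k} (f : B ⟶ C) : TensorEnd C Ω →* TensorEnd B Ω where
  toFun η := ⟨η.1.pull f.1, IsTensorEnd.pull f η⟩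
  map_one' := by
    have h : (1 : TensorEnd C Ω).1 = ofMap 0 (1 : C ⟶ Ω.toCCDGCoalg).1 :=
      (funext ofMap_convOne).symm
    refine Subtype.ext ?_
    change Fam.pull f.1 (1 : TensorEnd C Ω).1 = fun _ => LinearMap.id
    rw [h, pull_ofMap, ← funext ofMap_convOne]
    congr 1
    change (hone k Ω.carrier ∘ₗ cou k _) ∘ₗ f.1 = _
    rw [LinearMap.comp_assoc, f.2.counit]
  map_mul' a b := by
    obtain ⟨g, hg⟩ := a.exists_ofMap
    obtain ⟨h, hh⟩ := b.exists_ofMap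
    refine Subtype.ext ?_
    change Fam.pull f.1 (fun M => a.1 M ∘ₗ b.1 M) = fun M => a.1.pull f.1 M ∘ₗ b.1.pull f.1 M
    have e : convol 0 g.1 h.1 ∘ₗ f.1 = convol 0 (g.1 ∘ₗ f.1) (h.1 ∘ₗ f.1) :=
      congrArg Subtype.val (comp_mul f g h)
    rw [hg, hh, ← funext (ofMap_conv g.1 h.1), pull_ofMap, pull_ofMap, pull_ofMap, e]
    exact funext (ofMap_conv _ _)

theorem TensorEnd.res_rel {B : CCDGCoalg k} (f : B ⟶ C) {η η' : TensorEnd C Ω} (h : Rel η η') :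
    Rel (res f η) (res f η') := by
  obtain ⟨g, hg⟩ := η.exists_ofMap
  obtain ⟨g', hg'⟩ := η'.exists_ofMap
  change TensorHomotopic (η.1.pull f.1) (η'.1.pull f.1)
  change TensorHomotopic η.1 η'.1 at h
  rw [hg, hg', tensorHomotopic_ofMap_iff] at h
  rw [hg, hg', pull_ofMap, pull_ofMap]
  exact (tensorHomotopic_ofMap_iff _ _).2 (h.comp_right f.2)

theorem TensorEnd.res_homotopic {B : CCDGCoalg k} {f f' : B ⟶ C} (h : homotopyRel k f f')
    (η : TensorEnd C Ω) : Rel (res f η) (res f' η) := by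
  obtain ⟨g, hg⟩ := η.exists_ofMap
  change TensorHomotopic (η.1.pull f.1) (η.1.pull f'.1)
  rw [hg, pull_ofMap, pull_ofMap]
  exact (tensorHomotopic_ofMap_iff _ _).2 (Homotopic.comp_left h g.2)

theorem TensorEnd.res_id (η : TensorEnd C Ω) : res (𝟙 C) η = η := by
  obtain ⟨g, hg⟩ := η.exists_ofMap
  refine Subtype.ext ?_
  change η.1.pull LinearMap.id = η.1
  rw [hg, pull_ofMap, LinearMap.comp_id]

theorem TensorEnd.res_comp {A B : CCDGCoalg k} (f : A ⟶ B) (g : B ⟶ C) (η : TensorEnd C Ω) :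
    res (f ≫ g) η = res f (res g η) := by
  obtain ⟨h, hh⟩ := η.exists_ofMap
  refine Subtype.ext ?_
  change η.1.pull (g.1 ∘ₗ f.1) = (η.1.pull g.1).pull f.1
  rw [hh, pull_ofMap, pull_ofMap, pull_ofMap, LinearMap.comp_assoc]

/-- The presheaf of homotopy types of tensor natural endomorphisms on ccdg-coalgebras. -/
noncomputable def tannakaPresheafAux (Ω : CCDGHopf k) : (CCDGCoalg k)ᵒᵖ ⥤ GrpCat.{u + 1} where
  obj C := GrpCat.of (Quot (TensorEnd.Rel (C := C.unop) (Ω := Ω)))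
  map f := GrpCat.ofHom
    { toFun := Quot.map (TensorEnd.res f.unop) fun _ _ => TensorEnd.res_rel f.unop
      map_one' := congrArg (Quot.mk _) (map_one (TensorEnd.res f.unop))
      map_mul' := by
        rintro ⟨a⟩ ⟨b⟩; exact congrArg (Quot.mk _) (map_mul (TensorEnd.res f.unop) a b) }
  map_id C := by
    ext ⟨η⟩; exact congrArg (Quot.mk _) (TensorEnd.res_id η)
  map_comp f g := by
    ext ⟨η⟩; exact congrArg (Quot.mk _) (TensorEnd.res_comp g.unop f.unop η)

/-- The presheaf of groups on the homotopy category of ccdg-coalgebras that sends `C` to the group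
of homotopy types of tensor natural endomorphisms of `C ⊗ ω` that are cycles of degree `0`. -/
noncomputable def tannakaPresheaf (Ω : CCDGHopf k) : (HoCC k)ᵒᵖ ⥤ GrpCat.{u + 1} :=
  (CategoryTheory.Quotient.lift (homotopyRel k) (tannakaPresheafAux Ω).rightOp
    fun _ _ _ _ h => Quiver.Hom.unop_inj (by
      ext ⟨η⟩; exact Quot.sound (TensorEnd.res_homotopic h η))).leftOp

end TannakaPresheaf

end DGTannaka

namespace DGTannaka

/-! ### Morphisms into the Hopf algebra versus tensor natural endomorphisms. -/

section Representability

variable {k : Type u} [Field k]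

/-! The theorem is a Yoneda argument with coefficients in a coalgebra: a natural endomorphism of `C
⊗ ω` is determined by its effect on the unit of the free module `Ω`, and every condition imposed on
the family becomes a condition on that single value.

Two reductions give this. Since `C ⊗ M` is a cofree comodule, a comodule map `φ` is recovered from
`(ε ⊗ 1) ∘ φ` by applying `(1 ⊗ -) ∘ (Δ ⊗ 1)` (`pMap_qMap`, `qMap_pMap`). Next, for `z` of degree
`m` in a module `M`, the orbit map `ω ↦ (-1) ^ (m * |ω|) ω z` is a module morphism `Ω → M` of degree
`m` sending `1` to `z` (`isModHom_orbit`, `orbit_one`). It need not be a cycle, which is why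
naturality is required for morphisms of every degree and not only for chain maps. Naturality along
orbit maps shows that `η_M` is given by letting `a(c) = (ε ⊗ 1) η_Ω (c ⊗ 1)` act on `M`. Conversely,
every homogeneous linear map `a : C → Ω` defines a natural family of its degree in this way. Hence
`ofMap` and `toMap` are inverse to each other in each degree (`toMap_ofMap`, `ofMap_toMap`). The
degree is an argument of `ofMap` because `1 ⊗ a` carries a Koszul sign.

Under this dictionary the differential of the family is the differential of `a` (`homDif_ofMap`),
because the action and `Δ` are chain maps. The condition at the unit object says `ε ∘ a = ε`. In the
tensor condition, the left side is the action of `Δ ∘ a` on `M ⊗ M'` and the right side is the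
action of `(a ⊗ a) ∘ Δ`. For `M = M' = Ω`, evaluation at `1 ⊗ 1` detects the element of `Ω ⊗ Ω` that
acts (`act₂_self_injective`), so the condition is exactly compatibility with comultiplication. Thus
tensor natural cycles of degree `0` are the same as morphisms of ccdg-coalgebras
(`isTensorEnd_ofMap_iff`).

The dictionary is linear, so it applies to each coefficient of a polynomial in `t`, with `ofMap 0`
on the functions and `ofMap 1` on the homotopies. Every clause of a homotopy pair on one side
becomes the matching clause on the other; the endpoint at `t = 1` is a sum of coefficients and is
preserved too. The two notions of homotopy therefore agree on representatives
(`tensorHomotopic_ofMap_iff`), before any equivalence relation is generated.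

Group laws and restrictions also match. Associativity of the action turns convolution in `Ω` into
composition of families (`ofMap_conv`), and restriction along `f` becomes precomposition with `f`
(`pull_ofMap`). Convolution preserves coalgebra morphisms because `C` is cocommutative
(`midSwap_comul`, `IsCoalgHom.mul`), and inverses come from the antipode. That `ς ∘ g` is again a
morphism, although `ς` is only assumed linear of degree `0`, follows from uniqueness of convolution
inverses (`IsCoalgHom.antipode`).

What remains is to pass from these statements about representatives to quotients and to record
naturality in `C`. -/

/-- Morphisms of ccdg-coalgebras `C ⟶ Ω` correspond to tensor natural endomorphisms of `C ⊗ ω`, and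
convolution corresponds to composition. -/
noncomputable def homEquivTensorEnd (C : CCDGCoalg k) (Ω : CCDGHopf k) :
    (C ⟶ Ω.toCCDGCoalg) ≃* TensorEnd C Ω where
  toFun g := ⟨ofMap 0 g.1, isTensorEnd_ofMap g⟩
  -- The value at the unit of `Ω` is a coalgebra morphism because `η` is already known to be induced
  -- by some morphism `g`; evaluating at the unit then returns `g`.
  invFun η := ⟨toMap η.1, by
    obtain ⟨g, hg⟩ := η.exists_ofMap
    rw [hg, toMap_ofMap]
    exact g.2⟩
  -- Evaluating the induced family on `Ω` at `c ⊗ 1` gives `g(c) · 1`, so this is the right unit law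
  -- of `Ω`.
  left_inv g := Subtype.ext (toMap_ofMap 0 g.1)
  -- This is the Yoneda step: it uses only that the components are comodule maps and are natural
  -- along orbit maps, not the compatibility with tensor products.
  right_inv η := Subtype.ext (ofMap_toMap η.2.toIsNatEnd)
  -- The factors keep their order: for left modules, the action of a product `x y` is the action of
  -- `y` followed by that of `x`, matching the product `η ∘ η'` of families.
  map_mul' g h := Subtype.ext (funext (ofMap_conv g.1 h.1))

/-- A homotopy pair on either side is a pair of polynomials whose coefficients correspond under
`ofMap` and `toMap` in degrees `0` and `1`. The equivalence already holds for the elementary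
relation of being joined by one homotopy pair, so neither symmetry nor transitivity of homotopy has
to be discussed. -/
theorem homEquivTensorEnd_rel_iff {C : CCDGCoalg k} {Ω : CCDGHopf k} (g h : C ⟶ Ω.toCCDGCoalg) :
    TensorEnd.Rel (homEquivTensorEnd C Ω g) (homEquivTensorEnd C Ω h) ↔ homotopyRel k g h :=
  tensorHomotopic_ofMap_iff g.1 h.1

/-- After composition with `ε ⊗ 1`, the family of `g` is the action precomposed with `g ⊗ 1`;
restriction inserts `f ⊗ 1` in front, which gives `(g ∘ f) ⊗ 1`. This is naturality in the coalgebra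
at the level of representatives. -/
theorem homEquivTensorEnd_comp {B C : CCDGCoalg k} {Ω : CCDGHopf k} (f : B ⟶ C)
    (g : C ⟶ Ω.toCCDGCoalg) :
    homEquivTensorEnd B Ω (f ≫ g) = TensorEnd.res f (homEquivTensorEnd C Ω g) :=
  Subtype.ext (pull_ofMap f.1 g.1).symm

/-! ### Descent to homotopy types. -/

/-- The correspondence of `homEquivTensorEnd` on homotopy types. -/
noncomputable def hoHomEquivTensorEnd (X : HoCC k) (Ω : CCDGHopf k) :
    (X ⟶ (ho k).obj Ω.toCCDGCoalg) ≃* Quot (TensorEnd.Rel (C := X.as) (Ω := Ω)) where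
  -- Morphisms in the quotient category are classes for the closure of the homotopy relation under
  -- composition. Homotopy is stable under composition on both sides, so this closure is the
  -- homotopy relation itself, and the comparison of elementary relations suffices for a bijection
  -- of quotients.
  toEquiv := Quot.congr (homEquivTensorEnd X.as Ω).toEquiv fun g h =>
    (HomRel.compClosure_iff_self (homotopyRel k) g h).trans (homEquivTensorEnd_rel_iff g h).symm
  map_mul' := by
    -- Both group laws on the quotients are induced from representatives, so multiplicativity is
    -- inherited from the morphism level.
    rintro ⟨g⟩ ⟨h⟩
    exact congrArg (Quot.mk _) ((homEquivTensorEnd X.as Ω).map_mul g h)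

/-- This is the only compatibility needed for both the isomorphism of presheaves and the
representability: it serves as the naturality square of the former and as the composition axiom of
the latter. -/
theorem hoHomEquivTensorEnd_comp {X Y : HoCC k} {Ω : CCDGHopf k} (f : X ⟶ Y)
    (g : Y ⟶ (ho k).obj Ω.toCCDGCoalg) :
    hoHomEquivTensorEnd X Ω (f ≫ g) =
      (tannakaPresheaf Ω).map f.op (hoHomEquivTensorEnd Y Ω g) := by
  -- Once representatives are chosen for both classes, restriction in the presheaf unfolds to the
  -- class of the restricted family. Independence of the representative of `f` is already built into
  -- `tannakaPresheaf` through `TensorEnd.res_homotopic`.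
  obtain ⟨f⟩ := f
  obtain ⟨g⟩ := g
  exact congrArg (Quot.mk _) (homEquivTensorEnd_comp f g)

/-! ### The isomorphism of presheaves and representability. -/

/-- The presheaf of homotopy types of tensor natural endomorphisms is isomorphic to the presheaf
of groups represented by the ccdg-Hopf algebra. -/
noncomputable def tannakaIso (Ω : CCDGHopf k) :
    tannakaPresheaf Ω ≅ hopfPresheaf Ω ⋙ GrpCat.uliftFunctor.{u + 1, u} :=
  -- The isomorphism is built from morphisms to families, the direction in which naturality has been
  -- established, and is reversed at the end. Its inverse is therefore the explicit map induced by
  -- `g ↦ ofMap 0 g`.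
  (NatIso.ofComponents (F := hopfPresheaf Ω ⋙ GrpCat.uliftFunctor.{u + 1, u})
    (G := tannakaPresheaf Ω)
    -- A family is indexed by all dg-modules with carrier in `Type u`, hence lives one universe
    -- above the morphisms into `Ω`. The lift only moves the group of morphisms up to that universe.
    (fun X => MulEquiv.toGrpIso (MulEquiv.ulift.trans (hoHomEquivTensorEnd X.unop Ω)))
    fun f => by
      ext ⟨g⟩
      exact hoHomEquivTensorEnd_comp f.unop g).symm

/-- The ccdg-Hopf algebra represents the presheaf of homotopy types of tensor natural
endomorphisms. -/
noncomputable def tannakaRepresentableBy (Ω : CCDGHopf k) :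
    (tannakaPresheaf Ω ⋙ forget GrpCat.{u + 1}).RepresentableBy ((ho k).obj Ω.toCCDGCoalg) where
  -- A representation allows morphisms and values of the presheaf to lie in different universes, so
  -- no lift appears here.
  homEquiv {X} := (hoHomEquivTensorEnd X Ω).toEquiv
  homEquiv_comp f g := hoHomEquivTensorEnd_comp f g

end Representability

end DGTannaka

/-- The final clause is what makes `Ω` the representing object through the isomorphism itself: the
bijection of the representation is required to be the inverse of the group isomorphism, so that the
universal element and the group structures belong to the same identification. -/
theorem mainTheorem1 (k : Type u) [Field k] [CharZero k] (Ω : DGTannaka.CCDGHopf k) :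
    ∃ (e : DGTannaka.tannakaPresheaf Ω ≅
          DGTannaka.hopfPresheaf Ω ⋙ GrpCat.uliftFunctor.{u + 1, u})
      (r : (DGTannaka.tannakaPresheaf Ω ⋙ forget GrpCat.{u + 1}).RepresentableBy
        ((DGTannaka.ho k).obj Ω.toCCDGCoalg)),
      ∀ (X : DGTannaka.HoCC k) (g : X ⟶ (DGTannaka.ho k).obj Ω.toCCDGCoalg),
        r.homEquiv g = e.inv.app (Opposite.op X) (ULift.up g) :=
  -- Both sides unfold to `hoHomEquivTensorEnd` applied to `g`, so the compatibility holds by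
  -- definition.
  ⟨DGTannaka.tannakaIso Ω, DGTannaka.tannakaRepresentableBy Ω, fun _ _ => rfl⟩
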